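/- Let $n\ge 1$ and let $\alpha\in(0,1/4]$ be such that $\alpha n$ is an integer. In the $\alpha$-Partial Matching problem ($\alpha\mathrm{PM}$), Alice receives a string $x\in\{0,1\}^n$, and Bob receives a sequence $M$ of $\alpha n$ pairwise disjoint pairs $(i_1,j_1),\dots,(i_{\alpha n},j_{\alpha n})$ of distinct elements of $\{1,\dots,n\}$ together with a string $w\in\{0,1\}^{\alpha n}$. Let $z\in\{0,1\}^{\alpha n}$ be given by $z_\ell=x_{i_\ell}\oplus x_{j_\ell}$, and let $\overline z$ be its bitwise complement. The promise is that $w=z$ or $w=\overline z$; the value of the (partial Boolean) function is $0$ if $w=z$ and $1$ if $w=\overline z$. For an error probability $\varepsilon\in(0,1/2)$, let $R^1_\varepsilon(\alpha\mathrm{PM})$ be the least $k$ for which there is a private-coin protocol in which Alice sends Bob a single $k$-bit message, after which Bob outputs, on every input satisfying the promise, the correct value with probability at least $1-\varepsilon$. Let $Q^1_\varepsilon(\alpha\mathrm{PM})$ be defined in the same way, where Alice's message is a $k$-qubit quantum state, which Bob measures, and no entanglement is shared beforehand. For every fixed $\varepsilon\in(0,1/2)$ (for instance $\varepsilon=1/3$),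 $$R^1_\varepsilon(\alpha\mathrm{PM})=\Theta\bigl(\sqrt{n/\alpha}\bigr)\qquad\text{and}\qquad Q^1_\varepsilon(\alpha\mathrm{PM})=O\bigl(\log(n)/\alpha\bigr),$$ where the implied constants depend only on $\varepsilon$ and not on $n$ or $\alpha$. In particular, for $\alpha=1/4$ (and $n$ a positive multiple of $4$) one has $R^1_\varepsilon=\Omega(\sqrt n)$ and $Q^1_\varepsilon=O(\log n)$, an exponential separation between quantum and classical one-way communication for a partial Boolean function. -/

import Mathlib

open scoped ENNReal ComplexOrder

/-- A partial Boolean function of two inputs, `x` (held by Alice) and `y` (held by Bob).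
The value `none` means that the input pair violates the promise. -/
abbrev PartialBoolFun (X Y : Type) : Type := X → Y → Option Bool

/-- A classical one-way protocol with private coins and `k` bits of communication: Alice's coins and
her input determine a distribution on `k`-bit messages, and Bob, on receiving a message, outputs a
bit with a distribution determined by the message and his input. -/
structure ClassicalOneWay (X Y : Type) (k : ℕ) where
  /-- The distribution of Alice's message on input `x`. -/
  message : X → PMF (Fin k → Bool)
  /-- The distribution of Bob's output on a given message and input `y`. -/
  decide : (Fin k → Bool) → Y → PMF Bool

/-- The distribution of Bob's output on the input pair `(x, y)`. -/
noncomputable def ClassicalOneWay.output {X Y : Type} {k : ℕ} (P : ClassicalOneWay X Y k)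
    (x : X) (y : Y) : PMF Bool :=
  (P.message x).bind fun t => P.decide t y

/-- On every input pair satisfying the promise, the output of the protocol is correct with
probability at least `1 - ε`. -/
def ClassicalOneWay.Computes {X Y : Type} {k : ℕ} (P : ClassicalOneWay X Y k)
    (f : PartialBoolFun X Y) (ε : ℝ) : Prop :=
  ∀ x y b, f x y = some b → 1 - ε ≤ (P.output x y b).toReal

/-- The classical one-way communication complexity of `f` with error probability `ε`: the least
number of bits in a classical one-way protocol for `f` with error `ε` (`⊤` if there is none). -/
noncomputable def classicalOneWayComplexity {X Y : Type} (f : PartialBoolFun X Y) (ε : ℝ) : ℕ∞ :=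
  ⨅ (k : ℕ) (_ : ∃ P : ClassicalOneWay X Y k, P.Computes f ε), (k : ℕ∞)

/-- A (mixed) state of `k` qubits: a density matrix in the computational basis `{0,1}^k`. -/
structure QubitState (k : ℕ) where
  /-- The density matrix. -/
  mat : Matrix (Fin k → Bool) (Fin k → Bool) ℂ
  posSemidef : mat.PosSemidef
  trace_eq_one : mat.trace = 1

/-- A two-outcome quantum measurement (POVM) on `k` qubits, with outcomes in `Bool`. -/
structure BinaryMeasurement (k : ℕ) where
  /-- The measurement operators. -/
  op : Bool → Matrix (Fin k → Bool) (Fin k → Bool) ℂ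
  posSemidef : ∀ b, (op b).PosSemidef
  sum_eq_one : op false + op true = 1

/-- The probability of outcome `b` when the state `ρ` is measured with `E` (the Born rule). -/
noncomputable def BinaryMeasurement.prob {k : ℕ} (E : BinaryMeasurement k) (ρ : QubitState k)
    (b : Bool) : ℝ :=
  (E.op b * ρ.mat).trace.re

/-- A quantum one-way protocol (without prior entanglement) with `k` qubits of communication: Alice
sends a `k`-qubit state depending on her input, and Bob outputs the outcome of a measurement that
depends on his input. -/
structure QuantumOneWay (X Y : Type) (k : ℕ) where
  /-- The state sent by Alice on input `x`. -/
  message : X → QubitState k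
  /-- The measurement performed by Bob on input `y`. -/
  measurement : Y → BinaryMeasurement k

/-- On every input pair satisfying the promise, the output of the protocol is correct with
probability at least `1 - ε`. -/
def QuantumOneWay.Computes {X Y : Type} {k : ℕ} (P : QuantumOneWay X Y k)
    (f : PartialBoolFun X Y) (ε : ℝ) : Prop :=
  ∀ x y b, f x y = some b → 1 - ε ≤ (P.measurement y).prob (P.message x) b

/-- The quantum one-way communication complexity of `f` with error probability `ε`: the least
number of qubits in a quantum one-way protocol for `f` with error `ε` (`⊤` if there is none). -/
noncomputable def quantumOneWayComplexity {X Y : Type} (f : PartialBoolFun X Y) (ε : ℝ) : ℕ∞ :=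
  ⨅ (k : ℕ) (_ : ∃ P : QuantumOneWay X Y k, P.Computes f ε), (k : ℕ∞)

/-- A sequence of `m` disjoint pairs `(i₁, j₁), …, (iₘ, jₘ)` of elements of an `n`-element set:
the `2m` endpoints are pairwise distinct. -/
structure PartialMatching (n m : ℕ) where
  /-- The first endpoints `i₁, …, iₘ`. -/
  left : Fin m → Fin n
  /-- The second endpoints `j₁, …, jₘ`. -/
  right : Fin m → Fin n
  endpoints_injective : Function.Injective (Sum.elim left right)

/-- The string of the parities of the edges of `M`: its `l`-th bit is the sum modulo 2 of the bits
of `x` at the two endpoints of the `l`-th edge. -/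
def PartialMatching.parities {n m : ℕ} (M : PartialMatching n m) (x : Fin n → Bool) :
    Fin m → Bool :=
  fun l => xor (x (M.left l)) (x (M.right l))

/-- The Partial Matching problem. Alice holds `x ∈ {0,1}ⁿ`; Bob holds a matching `M` with `m` edges
and a string `w ∈ {0,1}ᵐ`. The promise is that `w` is the string of parities `z` or its complement;
the value is `0` in the first case and `1` in the second. -/
def partialMatchingProblem (n m : ℕ) :
    PartialBoolFun (Fin n → Bool) (PartialMatching n m × (Fin m → Bool)) :=
  fun x y =>
    if y.2 = y.1.parities x then some false
    else if y.2 = (fun l => !(y.1.parities x l)) then some true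
    else none

/-! With `m = α n` one has `√(n / α) = n / √m`, and the three bounds are proved in terms of `n` and
`m`.

Classical lower bound. Fix a message `t` and let `g x` be the probability that Alice sends `t` on
`x`. Bob's advantage is an odd function of the parity string. A character of the parities is a
character of `x` indexed by a union of edges, so Cauchy–Schwarz bounds the advantage by the Fourier
weight of `g` on nonempty unions of edges (`PartialMatching.sq_sum_mul_parities_le`). Averaging over
vertex permutations of the matching turns this weight into a combination of level weights with the
small factors `edgeUnionProb` (`PartialMatching.sum_weight_permute`). If `g` has mean at least `2 ^
(-c)`, the level inequality (`levelWeight_pow_le`, a consequence of Bonami's hypercontractivity)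
makes the total a small multiple of the squared mean as soon as `c` is a small multiple of `n / √m`.
With `c = k + s`, the messages of smaller mean contribute at most `2 ^ (-s)` altogether. Hence a
short protocol has too small an advantage.

Classical upper bound. By the birthday paradox, a random set of about `n / √m` vertices contains an
edge with large probability; Alice sends the set and her bits on it. The set comes from a 4-wise
independent hash function, so that its description is short and Chebyshev's inequality applies.

Quantum upper bound. Alice sends about `n / m` copies of the superposition of all vertices with
signs `(-1) ^ x i`. Bob projects away from `m` edge vectors that are orthogonal to the state if `w`
is the parity string, and that carry mass `2 * m / n` if `w` is its complement. The error is
one-sided, and copies reduce it. -/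

/-! ### Walsh–Fourier analysis on the Boolean cube. -/

/-- The sign `(-1) ^ b` of a bit. -/
def boolSign (b : Bool) : ℝ := if b then -1 else 1

theorem boolSign_mul_self (b : Bool) : boolSign b * boolSign b = 1 := by
  cases b <;> simp [boolSign]

theorem boolSign_not (b : Bool) : boolSign (!b) = -boolSign b := by
  cases b <;> simp [boolSign]

theorem boolSign_xor (a b : Bool) : boolSign (xor a b) = boolSign a * boolSign b := by
  cases a <;> cases b <;> simp [boolSign]

/-- The Walsh character of the Boolean cube indexed by the set `S`. -/
def walsh {ι : Type*} (S : Finset ι) (x : ι → Bool) : ℝ := ∏ i ∈ S, boolSign (x i)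

/-- The Walsh–Fourier coefficient of `g` at the set `S`. -/
noncomputable def walshCoeff {ι : Type*} [Fintype ι] [DecidableEq ι] (g : (ι → Bool) → ℝ)
    (S : Finset ι) : ℝ :=
  (∑ x, g x * walsh S x) / 2 ^ Fintype.card ι

/-- The sum factors as the product of `1 + boolSign (x i) * boolSign (y i)`, and a factor vanishes
wherever `x` and `y` differ. -/
theorem sum_walsh_mul_walsh {ι : Type*} [Fintype ι] (x y : ι → Bool) :
    ∑ S : Finset ι, walsh S x * walsh S y = if x = y then 2 ^ Fintype.card ι else 0 := by
  have h : ∑ S : Finset ι, walsh S x * walsh S y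
      = ∏ i : ι, (1 + boolSign (x i) * boolSign (y i)) := by
    rw [Finset.prod_one_add, Finset.powerset_univ]
    refine Finset.sum_congr rfl fun S _ => ?_
    simp [walsh, Finset.prod_mul_distrib]
  rw [h]
  split_ifs with hxy
  · subst hxy
    simp only [boolSign_mul_self]
    norm_num
  · obtain ⟨i, hi⟩ := Function.ne_iff.mp hxy
    refine Finset.prod_eq_zero (Finset.mem_univ i) ?_
    revert hi
    cases x i <;> cases y i <;> simp [boolSign]

section Walsh

variable {ι : Type*} [DecidableEq ι]

theorem walsh_insert {i : ι} {S : Finset ι} (h : i ∉ S) (x : ι → Bool) :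
    walsh (insert i S) x = boolSign (x i) * walsh S x := by
  simp [walsh, Finset.prod_insert h]

theorem walsh_update_of_notMem {i : ι} {S : Finset ι} (h : i ∉ S) (x : ι → Bool) (b : Bool) :
    walsh S (Function.update x i b) = walsh S x := by
  refine Finset.prod_congr rfl fun j hj => ?_
  rw [Function.update_of_ne (by rintro rfl; exact h hj)]

variable [Fintype ι]

theorem sum_walshCoeff_mul_walsh (g : (ι → Bool) → ℝ) (x : ι → Bool) :
    ∑ S : Finset ι, walshCoeff g S * walsh S x = g x := by
  have h2 : (2 : ℝ) ^ Fintype.card ι ≠ 0 := by positivity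
  have h : ∀ S : Finset ι, walshCoeff g S * walsh S x
      = ∑ y, (g y / 2 ^ Fintype.card ι) * (walsh S y * walsh S x) := by
    intro S
    rw [walshCoeff, Finset.sum_div, Finset.sum_mul]
    refine Finset.sum_congr rfl fun y _ => ?_
    ring
  simp_rw [h]
  rw [Finset.sum_comm]
  simp_rw [← Finset.mul_sum, sum_walsh_mul_walsh]
  simp [h2]

theorem sum_mul_sum_walsh (g : (ι → Bool) → ℝ) (s : Finset (Finset ι)) (a : Finset ι → ℝ) :
    ∑ x, g x * ∑ S ∈ s, a S * walsh S x
      = 2 ^ Fintype.card ι * ∑ S ∈ s, a S * walshCoeff g S := by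
  have h2 : (2 : ℝ) ^ Fintype.card ι ≠ 0 := by positivity
  simp_rw [Finset.mul_sum]
  rw [Finset.sum_comm]
  refine Finset.sum_congr rfl fun S _ => ?_
  rw [walshCoeff, mul_div_assoc', mul_div_assoc', mul_div_cancel_left₀ _ h2, Finset.mul_sum]
  refine Finset.sum_congr rfl fun x _ => ?_
  ring

theorem sum_walshCoeff_sq (g : (ι → Bool) → ℝ) :
    2 ^ Fintype.card ι * ∑ S : Finset ι, walshCoeff g S ^ 2 = ∑ x, g x ^ 2 := by
  simp_rw [sq]
  rw [← sum_mul_sum_walsh]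
  simp_rw [sum_walshCoeff_mul_walsh]

/-! ### Bonami's hypercontractive inequality for even exponents. -/

theorem sum_range_two_mul_succ (f : ℕ → ℝ) (s : ℕ) :
    ∑ k ∈ Finset.range (2 * s + 1), f k
      = ∑ i ∈ Finset.range (s + 1), f (2 * i) + ∑ i ∈ Finset.range s, f (2 * i + 1) := by
  induction s with
  | zero => simp
  | succ s ih =>
    rw [show 2 * (s + 1) + 1 = 2 * s + 1 + 1 + 1 by ring, Finset.sum_range_succ,
      Finset.sum_range_succ, ih, Finset.sum_range_succ _ (s + 1),
      Finset.sum_range_succ (fun i => f (2 * i + 1)) s, show 2 * (s + 1) = 2 * s + 1 + 1 by ring]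
    ring

/-- When `i` increases by one, the quotient of the two binomials grows by `(2 * s - 2 * i - 1) / (2
* i + 1)`, which is at most `2 * s - 1`. -/
theorem choose_two_mul_two_mul_le (s i : ℕ) :
    (2 * s).choose (2 * i) ≤ (2 * s - 1) ^ i * s.choose i := by
  induction i with
  | zero => simp
  | succ i ih =>
    rcases Nat.lt_or_ge i s with his | his
    · have h1 := Nat.choose_succ_right_eq (2 * s) (2 * i)
      have h2 := Nat.choose_succ_right_eq (2 * s) (2 * i + 1)
      have h3 := Nat.choose_succ_right_eq s i
      obtain ⟨d, rfl⟩ := Nat.exists_eq_add_of_lt his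
      rw [show 2 * (i + d + 1) - 2 * i = 2 * (d + 1) by omega] at h1
      rw [show 2 * (i + d + 1) - (2 * i + 1) = 2 * d + 1 by omega] at h2
      rw [show i + d + 1 - i = d + 1 by omega] at h3
      rw [show 2 * (i + 1) = 2 * i + 1 + 1 by ring]
      have hq : 2 * d + 1 ≤ 2 * (i + d + 1) - 1 := by omega
      set q := 2 * (i + d + 1) - 1
      set N := 2 * (i + d + 1)
      have hpos : 0 < (2 * i + 1 + 1) * (2 * i + 1) := by positivity
      refine Nat.le_of_mul_le_mul_right ?_ hpos
      calc N.choose (2 * i + 1 + 1) * ((2 * i + 1 + 1) * (2 * i + 1))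
          = N.choose (2 * i) * (2 * (d + 1) * (2 * d + 1)) := by
            linear_combination (2 * i + 1) * h2 + (2 * d + 1) * h1
        _ ≤ (q ^ i * (i + d + 1).choose i) * (2 * (d + 1) * q) := by gcongr
        _ = (q ^ (i + 1) * (i + d + 1).choose (i + 1)) * (2 * (i + 1)) := by
            rw [mul_assoc (q ^ (i + 1)), mul_left_comm _ 2, h3]
            ring
        _ ≤ (q ^ (i + 1) * (i + d + 1).choose (i + 1)) * ((2 * i + 1 + 1) * (2 * i + 1)) := by
            refine Nat.mul_le_mul_left _ ?_
            nlinarith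
    · rw [Nat.choose_eq_zero_of_lt (by omega)]
      exact Nat.zero_le _

/-- This is hypercontractivity for a single bit. The odd terms of the two binomial expansions
cancel, and the even ones are compared coefficient by coefficient. -/
theorem two_point_pow_le (s : ℕ) (p q : ℝ) :
    (p + q) ^ (2 * s) + (p - q) ^ (2 * s) ≤ 2 * (p ^ 2 + ((2 * s - 1 : ℕ) : ℝ) * q ^ 2) ^ s := by
  have e1 : (p + q) ^ (2 * s) + (p - q) ^ (2 * s)
      = 2 * ∑ i ∈ Finset.range (s + 1),
        (q ^ 2) ^ i * (p ^ 2) ^ (s - i) * ((2 * s).choose (2 * i) : ℝ) := by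
    rw [add_comm p q, sub_eq_add_neg p q, add_comm p (-q), add_pow, add_pow,
      sum_range_two_mul_succ, sum_range_two_mul_succ]
    have ho : ∑ i ∈ Finset.range s,
          (-q) ^ (2 * i + 1) * p ^ (2 * s - (2 * i + 1)) * ((2 * s).choose (2 * i + 1) : ℝ)
        = -∑ i ∈ Finset.range s,
          q ^ (2 * i + 1) * p ^ (2 * s - (2 * i + 1)) * ((2 * s).choose (2 * i + 1) : ℝ) := by
      rw [← Finset.sum_neg_distrib]
      refine Finset.sum_congr rfl fun i _ => ?_
      rw [Odd.neg_pow ⟨i, rfl⟩]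
      ring
    have he : ∑ i ∈ Finset.range (s + 1),
          (-q) ^ (2 * i) * p ^ (2 * s - 2 * i) * ((2 * s).choose (2 * i) : ℝ)
        = ∑ i ∈ Finset.range (s + 1),
          q ^ (2 * i) * p ^ (2 * s - 2 * i) * ((2 * s).choose (2 * i) : ℝ) := by
      refine Finset.sum_congr rfl fun i _ => ?_
      rw [Even.neg_pow ⟨i, two_mul i⟩]
    rw [ho, he]
    simp_rw [← pow_mul, Nat.mul_sub]
    ring
  rw [e1, add_comm (p ^ 2), add_pow]
  refine mul_le_mul_of_nonneg_left (Finset.sum_le_sum fun i _ => ?_) zero_le_two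
  have := choose_two_mul_two_mul_le s i
  have h : ((2 * s).choose (2 * i) : ℝ) ≤ ((2 * s - 1 : ℕ) : ℝ) ^ i * (s.choose i : ℝ) := by
    exact_mod_cast this
  rw [mul_pow]
  calc (q ^ 2) ^ i * (p ^ 2) ^ (s - i) * ((2 * s).choose (2 * i) : ℝ)
      ≤ (q ^ 2) ^ i * (p ^ 2) ^ (s - i) * (((2 * s - 1 : ℕ) : ℝ) ^ i * (s.choose i : ℝ)) := by
        gcongr
    _ = _ := by ring

/-- Minkowski's inequality in `Lˢ`, freed of roots. It adds up the two halves in the induction on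
coordinates below. -/
theorem sum_add_pow_le_of_sum_pow_le {κ : Type*} (t : Finset κ) {s : ℕ} (hs : 0 < s)
    {u v : κ → ℝ} (hu : ∀ x ∈ t, 0 ≤ u x) (hv : ∀ x ∈ t, 0 ≤ v x) {N A B : ℝ} (hN : 0 ≤ N)
    (hA : 0 ≤ A) (hB : 0 ≤ B) (hAu : ∑ x ∈ t, u x ^ s ≤ N * A ^ s)
    (hBv : ∑ x ∈ t, v x ^ s ≤ N * B ^ s) :
    ∑ x ∈ t, (u x + v x) ^ s ≤ N * (A + B) ^ s := by
  have hs' : (1 : ℝ) ≤ s := by exact_mod_cast hs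
  have hs0 : (s : ℝ) ≠ 0 := by positivity
  have h := Real.Lp_add_le_of_nonneg t hs' hu hv
  simp only [Real.rpow_natCast] at h
  have key : ∀ {X C : ℝ}, 0 ≤ X → 0 ≤ C → X ≤ N * C ^ s →
      X ^ (1 / (s : ℝ)) ≤ N ^ (1 / (s : ℝ)) * C := by
    intro X C hX hC hXC
    calc X ^ (1 / (s : ℝ)) ≤ (N * C ^ s) ^ (1 / (s : ℝ)) :=
          Real.rpow_le_rpow hX hXC (by positivity)
      _ = N ^ (1 / (s : ℝ)) * C := by
          rw [Real.mul_rpow hN (by positivity), ← Real.rpow_natCast C s, ← Real.rpow_mul hC,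
            mul_one_div_cancel hs0, Real.rpow_one]
  have hX : 0 ≤ ∑ x ∈ t, (u x + v x) ^ s :=
    Finset.sum_nonneg fun x hx => pow_nonneg (add_nonneg (hu x hx) (hv x hx)) _
  have h1 : (∑ x ∈ t, (u x + v x) ^ s) ^ (1 / (s : ℝ)) ≤ N ^ (1 / (s : ℝ)) * (A + B) := by
    have := key (Finset.sum_nonneg fun x hx => pow_nonneg (hu x hx) s) hA hAu
    have := key (Finset.sum_nonneg fun x hx => pow_nonneg (hv x hx) s) hB hBv
    linarith
  have h2 := pow_le_pow_left₀ (Real.rpow_nonneg hX _) h1 s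
  rwa [mul_pow, ← Real.rpow_natCast, ← Real.rpow_natCast (N ^ _), ← Real.rpow_mul hX,
    ← Real.rpow_mul hN, one_div_mul_cancel hs0, Real.rpow_one, Real.rpow_one] at h2

/-- The hypercontractive inequality of Bonami from `L²` to `L²ˢ`, on characters supported in `U`. -/
theorem sum_walsh_pow_le_powerset {s : ℕ} (hs : 0 < s) (U : Finset ι) (a : Finset ι → ℝ) :
    ∑ x : ι → Bool, (∑ S ∈ U.powerset, a S * walsh S x) ^ (2 * s)
      ≤ 2 ^ Fintype.card ι
        * (∑ S ∈ U.powerset, ((2 * s - 1 : ℕ) : ℝ) ^ S.card * a S ^ 2) ^ s := by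
  induction U using Finset.induction_on generalizing a with
  | empty => simp [walsh, ← pow_mul]
  | insert i U hi ih =>
    set q : ℝ := ((2 * s - 1 : ℕ) : ℝ)
    have hq : 0 ≤ q := by positivity
    let P : (ι → Bool) → ℝ := fun x => ∑ S ∈ U.powerset, a S * walsh S x
    let Q : (ι → Bool) → ℝ := fun x => ∑ S ∈ U.powerset, a (insert i S) * walsh S x
    have hnot : ∀ S ∈ U.powerset, i ∉ S := fun S hS h => hi (Finset.mem_powerset.mp hS h)
    have hsplit : ∀ x, ∑ S ∈ (insert i U).powerset, a S * walsh S x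
        = P x + boolSign (x i) * Q x := by
      intro x
      rw [Finset.sum_powerset_insert hi]
      congr 1
      rw [Finset.mul_sum]
      refine Finset.sum_congr rfl fun S hS => ?_
      rw [walsh_insert (hnot S hS)]
      ring
    have hcoef : ∑ S ∈ (insert i U).powerset, q ^ S.card * a S ^ 2
        = ∑ S ∈ U.powerset, q ^ S.card * a S ^ 2
          + q * ∑ S ∈ U.powerset, q ^ S.card * a (insert i S) ^ 2 := by
      rw [Finset.sum_powerset_insert hi]
      congr 1
      rw [Finset.mul_sum]
      refine Finset.sum_congr rfl fun S hS => ?_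
      rw [Finset.card_insert_of_notMem (hnot S hS)]
      ring
    simp_rw [hsplit]
    rw [hcoef]
    let flip : (ι → Bool) ≃ (ι → Bool) := Function.Involutive.toPerm
      (fun x => Function.update x i (!(x i))) (fun x => by simp)
    have hflip : ∀ x, flip x = Function.update x i (!(x i)) := fun x => rfl
    have hP : ∀ x, P (flip x) = P x := fun x => Finset.sum_congr rfl fun S hS => by
      rw [hflip, walsh_update_of_notMem (hnot S hS)]
    have hQ : ∀ x, Q (flip x) = Q x := fun x => Finset.sum_congr rfl fun S hS => by
      rw [hflip, walsh_update_of_notMem (hnot S hS)]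
    -- Neither `P` nor `Q` depends on bit `i`, so flipping that bit only changes the sign in front
    -- of `Q`. Averaging both forms of the sum produces the left side of `two_point_pow_le`.
    have hre : ∑ x, (P x + boolSign (x i) * Q x) ^ (2 * s)
        = ∑ x, (P x - boolSign (x i) * Q x) ^ (2 * s) := by
      rw [← Equiv.sum_comp flip]
      refine Finset.sum_congr rfl fun x _ => ?_
      rw [hP, hQ, hflip, Function.update_self, boolSign_not]
      ring
    have hle : ∑ x, (P x + boolSign (x i) * Q x) ^ (2 * s)
        ≤ ∑ x, (P x ^ 2 + q * Q x ^ 2) ^ s := by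
      have : ∑ x, ((P x + boolSign (x i) * Q x) ^ (2 * s)
          + (P x - boolSign (x i) * Q x) ^ (2 * s))
          ≤ ∑ x, 2 * (P x ^ 2 + q * Q x ^ 2) ^ s := by
        refine Finset.sum_le_sum fun x _ => ?_
        have h := two_point_pow_le s (P x) (boolSign (x i) * Q x)
        rwa [mul_pow (boolSign _), sq (boolSign _), boolSign_mul_self, one_mul] at h
      rw [Finset.sum_add_distrib, ← hre, ← Finset.mul_sum] at this
      linarith
    refine hle.trans (sum_add_pow_le_of_sum_pow_le Finset.univ hs (fun x _ => sq_nonneg _)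
      (fun x _ => by positivity) (by positivity) (Finset.sum_nonneg fun S _ => by positivity)
      (mul_nonneg hq (Finset.sum_nonneg fun S _ => by positivity)) ?_ ?_)
    · simp_rw [← pow_mul]
      exact ih a
    · simp_rw [mul_pow, ← Finset.mul_sum, ← pow_mul]
      rw [mul_left_comm]
      exact mul_le_mul_of_nonneg_left (ih fun S => a (insert i S)) (by positivity)

theorem sum_walsh_pow_le {s : ℕ} (hs : 0 < s) (t : Finset (Finset ι)) (a : Finset ι → ℝ) :
    ∑ x : ι → Bool, (∑ S ∈ t, a S * walsh S x) ^ (2 * s)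
      ≤ 2 ^ Fintype.card ι * (∑ S ∈ t, ((2 * s - 1 : ℕ) : ℝ) ^ S.card * a S ^ 2) ^ s := by
  have h := sum_walsh_pow_le_powerset hs Finset.univ fun S => if S ∈ t then a S else 0
  rw [Finset.powerset_univ] at h
  simpa [ite_pow, Finset.sum_ite_mem] using h

/-! ### Level weights and the level inequality. -/

/-- The Fourier weight of `g` on level `d`. -/
noncomputable def levelWeight (g : (ι → Bool) → ℝ) (d : ℕ) : ℝ :=
  ∑ S ∈ Finset.univ.powersetCard d, walshCoeff g S ^ 2

theorem levelWeight_nonneg (g : (ι → Bool) → ℝ) (d : ℕ) : 0 ≤ levelWeight g d :=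
  Finset.sum_nonneg fun _ _ => sq_nonneg _

/-- The power mean inequality for the normalised weights `w`, with the case of total weight zero
treated apart. -/
theorem sum_mul_pow_le {κ : Type*} (t : Finset κ) {w z : κ → ℝ} (hw : ∀ x ∈ t, 0 ≤ w x)
    (r : ℕ) (hz : ∀ x ∈ t, 0 ≤ z x) :
    (∑ x ∈ t, w x * z x) ^ (r + 1) ≤ (∑ x ∈ t, w x) ^ r * ∑ x ∈ t, w x * z x ^ (r + 1) := by
  rcases (Finset.sum_nonneg hw).eq_or_lt with h | h
  · have h0 := (Finset.sum_eq_zero_iff_of_nonneg hw).mp h.symm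
    rw [Finset.sum_eq_zero fun x hx => by rw [h0 x hx, zero_mul], zero_pow (by simp)]
    exact mul_nonneg (pow_nonneg (Finset.sum_nonneg hw) _)
      (Finset.sum_nonneg fun x hx => mul_nonneg (hw x hx) (pow_nonneg (hz x hx) _))
  · set W := ∑ x ∈ t, w x
    have h1 := Real.pow_arith_mean_le_arith_mean_pow t (fun x => w x / W) z
      (fun x hx => div_nonneg (hw x hx) h.le) (by rw [← Finset.sum_div, div_self h.ne']) hz (r + 1)
    simp_rw [div_mul_eq_mul_div, ← Finset.sum_div] at h1
    rw [div_pow, div_le_iff₀ (by positivity)] at h1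
    refine h1.trans (le_of_eq ?_)
    rw [pow_succ W]
    field_simp

/-- The level inequality of Kahn, Kalai and Linial, in moment form. -/
theorem levelWeight_pow_le {g : (ι → Bool) → ℝ} (hg0 : ∀ x, 0 ≤ g x) (hg1 : ∀ x, g x ≤ 1)
    {s : ℕ} (hs : 0 < s) (d : ℕ) :
    levelWeight g d ^ s ≤ walshCoeff g ∅ ^ (2 * s - 1) * ((2 * s - 1 : ℕ) : ℝ) ^ (d * s) := by
  set W := levelWeight g d with hWdef
  have hW0 : 0 ≤ W := levelWeight_nonneg g d
  have hmean : ∑ x, g x = 2 ^ Fintype.card ι * walshCoeff g ∅ := by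
    rw [walshCoeff, mul_div_cancel₀ _ (by positivity)]
    simp [walsh]
  have hμ0 : 0 ≤ walshCoeff g ∅ := by
    simp only [walshCoeff, walsh, Finset.prod_empty, mul_one]
    exact div_nonneg (Finset.sum_nonneg fun x _ => hg0 x) (by positivity)
  -- Pairing `g` with its own level-`d` part `h` gives the weight `W`. The power mean inequality and
  -- Bonami then bound `W ^ (2 * s)` by a multiple of `W ^ s`; cancelling `W ^ s` requires `W` to be
  -- positive.
  rcases hW0.eq_or_lt with h0 | hWpos
  · rw [← h0, zero_pow hs.ne']
    positivity
  set N : ℝ := 2 ^ Fintype.card ι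
  have hN : 0 < N := by positivity
  set h : (ι → Bool) → ℝ := fun x =>
    ∑ S ∈ Finset.univ.powersetCard d, walshCoeff g S * walsh S x with hh
  have h1 : ∑ x, g x * h x = N * W := by
    rw [hh, sum_mul_sum_walsh, hWdef, levelWeight]
    exact congrArg _ (Finset.sum_congr rfl fun S _ => (sq _).symm)
  have h2 : N * W ≤ ∑ x, g x * |h x| := by
    rw [← h1]
    exact Finset.sum_le_sum fun x _ => mul_le_mul_of_nonneg_left (le_abs_self _) (hg0 x)
  have h3 : ∑ x, h x ^ (2 * s) ≤ N * (((2 * s - 1 : ℕ) : ℝ) ^ d * W) ^ s := by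
    refine (sum_walsh_pow_le hs _ _).trans (le_of_eq ?_)
    rw [hWdef, levelWeight, Finset.mul_sum]
    congr 2
    refine Finset.sum_congr rfl fun S hS => ?_
    rw [(Finset.mem_powersetCard.mp hS).2]
  obtain ⟨r, hr⟩ : ∃ r, 2 * s = r + 1 := ⟨2 * s - 1, by omega⟩
  have hr' : 2 * s - 1 = r := by omega
  have h4 := sum_mul_pow_le Finset.univ (fun x _ => hg0 x) r (fun x _ => abs_nonneg (h x))
  have h5 : ∑ x, g x * |h x| ^ (r + 1) ≤ ∑ x, h x ^ (2 * s) := by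
    refine Finset.sum_le_sum fun x _ => ?_
    rw [← hr, Even.pow_abs ⟨s, two_mul s⟩]
    exact mul_le_of_le_one_left (by rw [pow_mul]; positivity) (hg1 x)
  have h6 : (N * W) ^ (2 * s) ≤ (N * walshCoeff g ∅) ^ r * (N * (((2 * s - 1 : ℕ) : ℝ) ^ d * W) ^ s) := by
    rw [hr, ← hmean]
    refine (pow_le_pow_left₀ (by positivity) h2 _).trans (h4.trans ?_)
    rw [← hr]
    exact mul_le_mul_of_nonneg_left (by rw [← hr] at h5; exact h5.trans h3)
      (pow_nonneg (Finset.sum_nonneg fun x _ => hg0 x) _)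
  have h7 : (N ^ (2 * s) * W ^ s) * W ^ s
      ≤ (N ^ (2 * s) * W ^ s) * (walshCoeff g ∅ ^ r * ((2 * s - 1 : ℕ) : ℝ) ^ (d * s)) := by
    calc (N ^ (2 * s) * W ^ s) * W ^ s = (N * W) ^ (2 * s) := by rw [mul_pow, two_mul s, pow_add, pow_add]; ring
      _ ≤ _ := h6
      _ = _ := by
        rw [hr, mul_pow, mul_pow, pow_mul, pow_succ N]
        ring
  rw [hr']
  rw [hr'] at h7
  exact le_of_mul_le_mul_left h7 (by positivity)

end Walsh

/-! ### Averages over permutations. -/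

section PermutationAverage

variable {ι : Type*} [Fintype ι] [DecidableEq ι]

theorem exists_perm_map_eq {S T : Finset ι} (h : S.card = T.card) :
    ∃ σ : Equiv.Perm ι, S.map σ.toEmbedding = T := by
  have e : {x // x ∈ S} ≃ {x // x ∈ T} := Finset.equivOfCardEq h
  refine ⟨e.extendSubtype, Finset.eq_of_subset_of_card_le ?_ (by simp [h])⟩
  intro y hy
  obtain ⟨x, hx, rfl⟩ := Finset.mem_map.mp hy
  exact e.extendSubtype_mem x hx

/-- Double counting over pairs `(S, σ)` with `S.card = T.card`: the sum over `σ` does not depend on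
`S`, and the sum over `S` does not depend on `σ`. -/
theorem choose_mul_sum_perm (h : Finset ι → ℝ) (T : Finset ι) :
    ((Fintype.card ι).choose T.card : ℝ) * ∑ σ : Equiv.Perm ι, h (T.map σ.toEmbedding)
      = (Fintype.card (Equiv.Perm ι) : ℝ) * ∑ S ∈ Finset.univ.powersetCard T.card, h S := by
  have h1 : ∀ S ∈ Finset.univ.powersetCard T.card,
      ∑ σ : Equiv.Perm ι, h (S.map σ.toEmbedding)
        = ∑ σ : Equiv.Perm ι, h (T.map σ.toEmbedding) := by
    intro S hS
    obtain ⟨τ, rfl⟩ := exists_perm_map_eq (Finset.mem_powersetCard.mp hS).2.symm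
    rw [← Equiv.sum_comp (Equiv.mulRight τ) fun σ => h (T.map σ.toEmbedding)]
    refine Finset.sum_congr rfl fun σ _ => ?_
    rw [Finset.map_map]
    rfl
  have h2 : ∀ σ : Equiv.Perm ι, ∑ S ∈ Finset.univ.powersetCard T.card, h (S.map σ.toEmbedding)
      = ∑ S ∈ Finset.univ.powersetCard T.card, h S := by
    intro σ
    refine Finset.sum_equiv σ.finsetCongr (fun S => ?_) fun S _ => rfl
    simp [Finset.mem_powersetCard]
  have h3 := Finset.sum_comm (s := Finset.univ.powersetCard T.card)
    (t := (Finset.univ : Finset (Equiv.Perm ι))) (f := fun S σ => h (S.map σ.toEmbedding))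
  rw [Finset.sum_congr rfl h1, Finset.sum_congr rfl fun σ _ => h2 σ] at h3
  simpa [Finset.card_powersetCard] using h3

end PermutationAverage

/-! ### Characters of the parity string, and random matchings. -/

namespace PartialMatching

variable {n m : ℕ}

theorem left_injective (M : PartialMatching n m) : Function.Injective M.left :=
  fun a b h => Sum.inl_injective (M.endpoints_injective (a₁ := Sum.inl a) (a₂ := Sum.inl b) h)

theorem right_injective (M : PartialMatching n m) : Function.Injective M.right :=
  fun a b h => Sum.inr_injective (M.endpoints_injective (a₁ := Sum.inr a) (a₂ := Sum.inr b) h)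

theorem left_ne_right (M : PartialMatching n m) (a b : Fin m) : M.left a ≠ M.right b :=
  fun h => Sum.inl_ne_inr (M.endpoints_injective (a₁ := Sum.inl a) (a₂ := Sum.inr b) h)

/-- The set of all endpoints of the edges of `M` with index in `v`. -/
def endpoints (M : PartialMatching n m) (v : Finset (Fin m)) : Finset (Fin n) :=
  (v.map ⟨M.left, M.left_injective⟩).disjUnion (v.map ⟨M.right, M.right_injective⟩) (by
    rw [Finset.disjoint_left]
    simp only [Finset.mem_map, Function.Embedding.coeFn_mk, not_exists, not_and]
    rintro _ ⟨a, _, rfl⟩ b _ h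
    exact M.left_ne_right a b h.symm)

theorem card_endpoints (M : PartialMatching n m) (v : Finset (Fin m)) :
    (M.endpoints v).card = 2 * v.card := by
  rw [endpoints, Finset.card_disjUnion, Finset.card_map, Finset.card_map, two_mul]

theorem walsh_parities (M : PartialMatching n m) (v : Finset (Fin m)) (x : Fin n → Bool) :
    walsh v (M.parities x) = walsh (M.endpoints v) x := by
  rw [walsh, walsh, endpoints, Finset.prod_disjUnion, Finset.prod_map, Finset.prod_map,
    ← Finset.prod_mul_distrib]
  exact Finset.prod_congr rfl fun l _ => boolSign_xor _ _

/-- The image of a matching under a permutation of the vertices. -/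
def permute (M : PartialMatching n m) (σ : Equiv.Perm (Fin n)) : PartialMatching n m where
  left := σ ∘ M.left
  right := σ ∘ M.right
  endpoints_injective := by
    rw [← Sum.comp_elim]
    exact σ.injective.comp M.endpoints_injective

theorem endpoints_permute (M : PartialMatching n m) (σ : Equiv.Perm (Fin n))
    (v : Finset (Fin m)) : (M.permute σ).endpoints v = (M.endpoints v).map σ.toEmbedding := by
  ext x
  simp [endpoints, permute, Equiv.eq_symm_apply]

/-- The matching `(0, m), (1, m + 1), …, (m - 1, 2 * m - 1)`. -/
def standard (h : 2 * m ≤ n) : PartialMatching n m where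
  left l := ⟨l, by omega⟩
  right l := ⟨m + l, by omega⟩
  endpoints_injective := by
    rintro (a | a) (b | b) h <;> simp [Fin.ext_iff] at h ⊢ <;> omega

/-- The Fourier weight of `g` on the nonempty unions of edges of `M`. -/
noncomputable def weight (M : PartialMatching n m) (g : (Fin n → Bool) → ℝ) : ℝ :=
  ∑ v ∈ Finset.univ.erase (∅ : Finset (Fin m)), walshCoeff g (M.endpoints v) ^ 2

/-- Expand `h` in characters of the parity string, which are the characters of `x` at unions of
edges; then apply Cauchy–Schwarz, with Bessel's inequality for `h`. -/
theorem sq_sum_mul_parities_le (M : PartialMatching n m) (g : (Fin n → Bool) → ℝ)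
    (h : (Fin m → Bool) → ℝ) (hodd : ∀ z, h (fun l => !(z l)) = -h z) (h1 : ∀ z, |h z| ≤ 1) :
    (∑ x, g x * h (M.parities x)) ^ 2 ≤ (2 ^ n) ^ 2 * M.weight g := by
  -- Oddness removes the empty set, so the mean of `g` does not enter the bound.
  have hempty : walshCoeff h ∅ = 0 := by
    have e : ∑ z, h z = -∑ z, h z := by
      let flip : (Fin m → Bool) ≃ (Fin m → Bool) := Function.Involutive.toPerm
        (fun z l => !(z l)) (fun z => by simp)
      conv_lhs => rw [← Equiv.sum_comp flip]
      rw [← Finset.sum_neg_distrib]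
      exact Finset.sum_congr rfl fun z _ => hodd z
    have e0 : ∑ z, h z = 0 := by linarith
    simp [walshCoeff, walsh, e0]
  have hsum : ∑ x, g x * h (M.parities x)
      = 2 ^ n * ∑ v ∈ Finset.univ.erase (∅ : Finset (Fin m)),
        walshCoeff h v * walshCoeff g (M.endpoints v) := by
    rw [Finset.sum_erase _ (by rw [hempty, zero_mul]), Finset.mul_sum]
    have : ∀ x, g x * h (M.parities x)
        = ∑ v, walshCoeff h v * (g x * walsh (M.endpoints v) x) := by
      intro x
      rw [← sum_walshCoeff_mul_walsh h, Finset.mul_sum]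
      refine Finset.sum_congr rfl fun v _ => ?_
      rw [M.walsh_parities]
      ring
    simp_rw [this]
    rw [Finset.sum_comm]
    refine Finset.sum_congr rfl fun v _ => ?_
    rw [← Finset.mul_sum, walshCoeff.eq_def g, Fintype.card_fin]
    field_simp
  have hbessel : ∑ v ∈ Finset.univ.erase (∅ : Finset (Fin m)), walshCoeff h v ^ 2 ≤ 1 := by
    refine (Finset.sum_le_sum_of_subset_of_nonneg (Finset.erase_subset _ _)
      fun v _ _ => sq_nonneg _).trans ?_
    refine le_of_mul_le_mul_left (a := (2 : ℝ) ^ Fintype.card (Fin m)) ?_ (by positivity)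
    rw [sum_walshCoeff_sq]
    calc ∑ z, h z ^ 2 ≤ ∑ _z : Fin m → Bool, (1 : ℝ) :=
          Finset.sum_le_sum fun z _ => (sq_le_one_iff_abs_le_one _).mpr (h1 z)
      _ = _ := by simp
  rw [hsum, mul_pow]
  refine mul_le_mul_of_nonneg_left ((Finset.sum_mul_sq_le_sq_mul_sq _ _ _).trans ?_)
    (by positivity)
  exact mul_le_of_le_one_left (Finset.sum_nonneg fun _ _ => sq_nonneg _) hbessel

/-- A random permutation sends a union of `j` edges to a uniform set of size `2 * j`, and there are
`m.choose j` such unions. -/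
theorem sum_weight_permute (M : PartialMatching n m) (hmn : 2 * m ≤ n)
    (g : (Fin n → Bool) → ℝ) :
    ∑ σ, (M.permute σ).weight g = (Fintype.card (Equiv.Perm (Fin n)) : ℝ)
      * ∑ j ∈ Finset.Icc 1 m,
        (m.choose j : ℝ) / (n.choose (2 * j) : ℝ) * levelWeight g (2 * j) := by
  simp only [weight]
  rw [Finset.sum_comm]
  have h1 : ∀ v : Finset (Fin m), ∑ σ, walshCoeff g ((M.permute σ).endpoints v) ^ 2
      = (Fintype.card (Equiv.Perm (Fin n)) : ℝ)
        * (levelWeight g (2 * v.card) / (n.choose (2 * v.card) : ℝ)) := by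
    intro v
    have hv : v.card ≤ m := by simpa using v.card_le_univ
    have hpos : (0 : ℝ) < (n.choose (2 * v.card) : ℝ) := by
      exact_mod_cast Nat.choose_pos (by omega)
    have h := choose_mul_sum_perm (fun S => walshCoeff g S ^ 2) (M.endpoints v)
    simp only [card_endpoints, Fintype.card_fin] at h
    simp_rw [endpoints_permute]
    rw [mul_div_assoc', eq_div_iff hpos.ne', mul_comm, h, levelWeight]
  simp_rw [h1]
  rw [← Finset.mul_sum]
  congr 1
  have h2 := Finset.sum_powerset_apply_card (x := (Finset.univ : Finset (Fin m)))
    (fun j => if j = 0 then (0 : ℝ) else levelWeight g (2 * j) / (n.choose (2 * j) : ℝ))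
  have h3 : ∑ v ∈ Finset.univ.erase (∅ : Finset (Fin m)),
      levelWeight g (2 * v.card) / (n.choose (2 * v.card) : ℝ)
      = ∑ v ∈ (Finset.univ : Finset (Fin m)).powerset, if v.card = 0 then (0 : ℝ)
        else levelWeight g (2 * v.card) / (n.choose (2 * v.card) : ℝ) := by
    rw [Finset.powerset_univ, ← Finset.sum_erase Finset.univ (a := ∅) (by simp)]
    refine Finset.sum_congr rfl fun v hv => ?_
    rw [if_neg (by simpa using hv)]
  rw [h3, h2, Finset.card_fin, Finset.range_eq_Ico, Finset.sum_eq_sum_Ico_succ_bot (by omega)]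
  simp only [if_true, smul_zero, zero_add]
  refine Finset.sum_congr (by ext; simp) fun j hj => ?_
  rw [if_neg (by simp at hj; omega), nsmul_eq_mul]
  ring

end PartialMatching

/-! ### Numerical bounds on the averaged weight. -/

section Estimates

/-- The probability that a fixed set of `2 * j` out of `n` points is the union of `j` edges of a
random matching with `m` edges. -/
noncomputable def edgeUnionProb (n m j : ℕ) : ℝ := (m.choose j : ℝ) / (n.choose (2 * j) : ℝ)

theorem edgeUnionProb_nonneg (n m j : ℕ) : 0 ≤ edgeUnionProb n m j := by
  unfold edgeUnionProb
  positivity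

/-- The exact ratio is `2 * (m - j) * (2 * j + 1) / ((n - 2 * j) * (n - 2 * j - 1))`. Here `(m - j)
/ (n - 2 * j) ≤ m / n`, and `4 * m ≤ n` gives `n ≤ 2 * (n - 2 * j - 1)`. -/
theorem edgeUnionProb_succ_le {n m j : ℕ} (hmn : 4 * m ≤ n) (hj : j < m) :
    edgeUnionProb n m (j + 1) ≤ edgeUnionProb n m j * (4 * m * (2 * j + 1) / (n : ℝ) ^ 2) := by
  have h1 := Nat.choose_succ_right_eq n (2 * j)
  have h2 := Nat.choose_succ_right_eq n (2 * j + 1)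
  have h3 := Nat.choose_succ_right_eq m j
  have hp : 0 < n.choose (2 * j) := Nat.choose_pos (by omega)
  have hp' : 0 < n.choose (2 * j + 1 + 1) := Nat.choose_pos (by omega)
  have hjm : (j : ℝ) + 1 ≤ m := by exact_mod_cast hj
  have hmn' : 4 * (m : ℝ) ≤ n := by exact_mod_cast hmn
  have hj0 : (0 : ℝ) ≤ j := by positivity
  zify [show 2 * j ≤ n by omega, show 2 * j + 1 ≤ n by omega, hj.le] at h1 h2 h3
  have h1' : (n.choose (2 * j + 1) : ℝ) * (2 * j + 1) = n.choose (2 * j) * (n - 2 * j) := by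
    exact_mod_cast h1
  have h2' : (n.choose (2 * j + 1 + 1) : ℝ) * (2 * j + 1 + 1)
      = n.choose (2 * j + 1) * (n - (2 * j + 1)) := by
    exact_mod_cast h2
  have h3' : (m.choose (j + 1) : ℝ) * (j + 1) = m.choose j * (m - j) := by
    exact_mod_cast h3
  unfold edgeUnionProb
  rw [show 2 * (j + 1) = 2 * j + 1 + 1 by ring]
  have hpr : (0 : ℝ) < n.choose (2 * j) := by exact_mod_cast hp
  have hpr' : (0 : ℝ) < n.choose (2 * j + 1 + 1) := by exact_mod_cast hp'
  have hn : (0 : ℝ) < n := by linarith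
  rw [div_mul_div_comm, div_le_div_iff₀ hpr' (by positivity)]
  have e1 : (n.choose (2 * j + 1 + 1) : ℝ)
      = n.choose (2 * j) * ((n - 2 * j) * (n - (2 * j + 1))) / ((2 * j + 1) * (2 * j + 2)) := by
    rw [eq_div_iff (by positivity)]
    linear_combination (2 * (j : ℝ) + 1) * h2' + ((n : ℝ) - (2 * j + 1)) * h1'
  have e3 : (m.choose (j + 1) : ℝ) = m.choose j * (m - j) / (j + 1) := by
    rw [eq_div_iff (by positivity)]
    exact h3'
  rw [e1, e3]
  have key : ((m : ℝ) - j) * n ^ 2 ≤ 2 * m * ((n - 2 * j) * (n - (2 * j + 1))) := by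
    have k1 : ((m : ℝ) - j) * n ≤ m * (n - 2 * j) := by nlinarith
    have k2 : (n : ℝ) ≤ 2 * (n - (2 * j + 1)) := by linarith
    calc ((m : ℝ) - j) * n ^ 2 = ((m : ℝ) - j) * n * n := by ring
      _ ≤ (m * (n - 2 * j)) * (2 * (n - (2 * j + 1))) :=
          mul_le_mul k1 k2 hn.le (mul_nonneg (by linarith) (by linarith))
      _ = _ := by ring
  have hc : (0 : ℝ) ≤ m.choose j * n.choose (2 * j) / (j + 1) := by positivity
  have := mul_le_mul_of_nonneg_left key hc
  calc _ = (m.choose j : ℝ) * n.choose (2 * j) / (j + 1) * (((m : ℝ) - j) * n ^ 2) := by ring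
    _ ≤ _ := this
    _ = _ := by
      field_simp
      ring

/-- The bound `r` is kept separate from `j` so that the base of the power stays fixed during the
induction. -/
theorem edgeUnionProb_le_pow {n m j : ℕ} (hmn : 4 * m ≤ n) (hj : j ≤ m) {r : ℝ} (hr : (j : ℝ) ≤ r) :
    edgeUnionProb n m j ≤ (8 * m * r / (n : ℝ) ^ 2) ^ j := by
  induction j with
  | zero => simp [edgeUnionProb]
  | succ j ih =>
    push_cast at hr
    refine (edgeUnionProb_succ_le hmn hj).trans ?_
    rw [pow_succ]
    have hr0 : 0 ≤ r := le_trans (by positivity) hr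
    have hX : 0 ≤ 8 * m * r / (n : ℝ) ^ 2 := by positivity
    refine mul_le_mul (ih (by omega) (by linarith)) ?_ (by positivity) (pow_nonneg hX _)
    refine div_le_div_of_nonneg_right ?_ (by positivity)
    nlinarith [show (0 : ℝ) ≤ m by positivity]

theorem edgeUnionProb_antitone {n m i j : ℕ} (hmn : 4 * m ≤ n) (hij : i ≤ j) (hj : j ≤ m) :
    edgeUnionProb n m j ≤ edgeUnionProb n m i := by
  induction j, hij using Nat.le_induction with
  | base => exact le_rfl
  | succ j _ ih =>
    refine (edgeUnionProb_succ_le hmn hj).trans (le_trans ?_ (ih (by omega)))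
    refine mul_le_of_le_one_right (edgeUnionProb_nonneg _ _ _) ?_
    have h1 : (j : ℝ) + 1 ≤ m := by exact_mod_cast hj
    have h2 : 4 * (m : ℝ) ≤ n := by exact_mod_cast hmn
    have h0 : (0 : ℝ) ≤ j := by positivity
    rw [div_le_one (by nlinarith)]
    nlinarith

variable {ι : Type*} [Fintype ι] [DecidableEq ι]

/-- The level inequality with its moment `s` chosen near `c / j`, the order at which the missing
factor of the mean costs only a constant per unit of `j`. -/
theorem levelWeight_two_mul_le {g : (ι → Bool) → ℝ} (hg0 : ∀ x, 0 ≤ g x) (hg1 : ∀ x, g x ≤ 1)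
    {c j : ℕ} (hj : 0 < j) (hjc : j ≤ c) (hμ : 1 ≤ walshCoeff g ∅ * 2 ^ c) :
    levelWeight g (2 * j) ≤ walshCoeff g ∅ ^ 2 * (32 * (c : ℝ) ^ 2 / (j : ℝ) ^ 2) ^ j := by
  set μ := walshCoeff g ∅
  have hμ0 : 0 < μ := by
    by_contra h
    have : μ * 2 ^ c ≤ 0 := mul_nonpos_of_nonpos_of_nonneg (not_lt.mp h) (by positivity)
    linarith
  -- This choice gives `c ≤ j * s ≤ 2 * c`. The lower bound absorbs `2 ^ c` into `2 ^ (j * s)`; the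
  -- upper one gives `q ≤ 4 * c / j`.
  set s := c / j + 1 with hs
  have hs0 : 0 < s := Nat.succ_pos _
  have hd := Nat.div_add_mod c j
  have hm := Nat.mod_lt c hj
  have hdpos : 0 < c / j := Nat.div_pos hjc hj
  have hcs : c ≤ j * s := by rw [hs, mul_add, mul_one]; linarith
  have hjs : j * s ≤ 2 * c := by rw [hs, mul_add, mul_one]; linarith [Nat.zero_le (c % j)]
  have h := levelWeight_pow_le hg0 hg1 hs0 (2 * j)
  set q : ℝ := ((2 * s - 1 : ℕ) : ℝ) with hq
  have hq0 : 0 ≤ q := by positivity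
  have hqs : q ≤ 2 * s := by
    rw [hq]
    exact_mod_cast Nat.sub_le _ _
  have hjr : (0 : ℝ) < j := by exact_mod_cast hj
  have hqc : q ≤ 4 * c / j := by
    rw [le_div_iff₀ hjr]
    have : (j : ℝ) * s ≤ 2 * c := by exact_mod_cast hjs
    nlinarith
  have h1 : levelWeight g (2 * j) ^ s ≤ (μ ^ 2 * (2 * q ^ 2) ^ j) ^ s := by
    refine h.trans ?_
    have hμ' : μ ^ (2 * s - 1) ≤ μ ^ (2 * s) * 2 ^ (j * s) := by
      calc μ ^ (2 * s - 1) ≤ μ ^ (2 * s - 1) * (μ * 2 ^ c) :=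
            le_mul_of_one_le_right (by positivity) hμ
        _ = μ ^ (2 * s) * 2 ^ c := by
            rw [← mul_assoc, ← pow_succ, Nat.sub_add_cancel (by omega)]
        _ ≤ _ := by
            gcongr
            norm_num
    calc μ ^ (2 * s - 1) * q ^ (2 * j * s) ≤ μ ^ (2 * s) * 2 ^ (j * s) * q ^ (2 * j * s) := by
          gcongr
      _ = _ := by
          rw [mul_pow, mul_pow, mul_pow, ← pow_mul, ← pow_mul, ← pow_mul, ← pow_mul]
          ring
  have h2 := le_of_pow_le_pow_left₀ hs0.ne' (by positivity) h1
  refine h2.trans ?_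
  have : 2 * q ^ 2 ≤ 32 * (c : ℝ) ^ 2 / (j : ℝ) ^ 2 := by
    calc 2 * q ^ 2 ≤ 2 * (4 * c / j) ^ 2 := by gcongr
      _ = _ := by ring
  gcongr

theorem sum_levelWeight_le {g : (ι → Bool) → ℝ} (hg0 : ∀ x, 0 ≤ g x) (hg1 : ∀ x, g x ≤ 1)
    (s : Finset ℕ) : ∑ j ∈ s, levelWeight g (2 * j) ≤ walshCoeff g ∅ := by
  have h1 : ∑ j ∈ s, levelWeight g (2 * j) ≤ ∑ S : Finset ι, walshCoeff g S ^ 2 := by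
    simp only [levelWeight]
    rw [← Finset.sum_biUnion]
    · exact Finset.sum_le_sum_of_subset_of_nonneg (Finset.subset_univ _) fun _ _ _ => sq_nonneg _
    · intro i _ j _ hij
      exact Finset.pairwise_disjoint_powersetCard _ (by simpa using hij)
  have h2 : ∑ S : Finset ι, walshCoeff g S ^ 2 ≤ walshCoeff g ∅ := by
    refine le_of_mul_le_mul_left (a := (2 : ℝ) ^ Fintype.card ι) ?_ (by positivity)
    rw [sum_walshCoeff_sq, walshCoeff, mul_div_cancel₀ _ (by positivity)]
    refine Finset.sum_le_sum fun x _ => ?_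
    simp only [walsh, Finset.prod_empty, mul_one]
    nlinarith [hg0 x, hg1 x]
  exact h1.trans h2

/-- For `j ≤ c` the level inequality leaves a geometric series with ratio at most `256 * γ ^ 2`. For
`j > c` Parseval suffices: all level weights together are at most `μ ≤ μ ^ 2 * 2 ^ c`, and
`edgeUnionProb` has already fallen to its value at `c`. Each range contributes at most `16 * γ * μ ^
2`. -/
theorem sum_edgeUnionProb_mul_levelWeight_le {g : (ι → Bool) → ℝ} (hg0 : ∀ x, 0 ≤ g x)
    (hg1 : ∀ x, g x ≤ 1) {n m c : ℕ} (hn : 0 < n) (hmn : 4 * m ≤ n) (hc : 0 < c)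
    (hμ : 1 ≤ walshCoeff g ∅ * 2 ^ c) {γ : ℝ} (hγ0 : 0 ≤ γ) (hγ : γ ≤ 1 / 32)
    (hcγ : (c : ℝ) ^ 2 * m ≤ γ ^ 2 * (n : ℝ) ^ 2) :
    ∑ j ∈ Finset.Icc 1 m, edgeUnionProb n m j * levelWeight g (2 * j)
      ≤ 32 * γ * walshCoeff g ∅ ^ 2 := by
  set μ := walshCoeff g ∅ with hμdef
  have hnr : (0 : ℝ) < n := by exact_mod_cast hn
  have hmn' : 4 * (m : ℝ) ≤ n := by exact_mod_cast hmn
  have hm0 : (0 : ℝ) ≤ m := by positivity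
  have hc1 : (1 : ℝ) ≤ c := by exact_mod_cast hc
  have hμ0 : 0 ≤ μ := le_trans (Finset.sum_nonneg fun _ _ => levelWeight_nonneg _ _)
    (sum_levelWeight_le hg0 hg1 ∅)
  rw [← Finset.sum_filter_add_sum_filter_not (Finset.Icc 1 m) (· ≤ c)]
  have hlow : ∑ j ∈ (Finset.Icc 1 m).filter (· ≤ c),
      edgeUnionProb n m j * levelWeight g (2 * j) ≤ 16 * γ * μ ^ 2 := by
    have hterm : ∀ j ∈ (Finset.Icc 1 m).filter (· ≤ c),
        edgeUnionProb n m j * levelWeight g (2 * j) ≤ μ ^ 2 * (256 * γ ^ 2) * (1 / 2) ^ (j - 1) := by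
      intro j hj
      simp only [Finset.mem_filter, Finset.mem_Icc] at hj
      obtain ⟨⟨hj1, hjm⟩, hjc⟩ := hj
      have hj1' : (1 : ℝ) ≤ j := by exact_mod_cast hj1
      have hb : 8 * m * j / (n : ℝ) ^ 2 * (32 * (c : ℝ) ^ 2 / (j : ℝ) ^ 2) ≤ 256 * γ ^ 2 := by
        have e : 8 * m * j / (n : ℝ) ^ 2 * (32 * (c : ℝ) ^ 2 / (j : ℝ) ^ 2)
            = 256 * ((c : ℝ) ^ 2 * m / (n : ℝ) ^ 2) / j := by
          field_simp
          ring
        rw [e]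
        refine (div_le_self (by positivity) hj1').trans ?_
        gcongr
        rw [div_le_iff₀ (by positivity)]
        exact hcγ
      have hhalf : 256 * γ ^ 2 ≤ 1 / 2 := by nlinarith
      calc edgeUnionProb n m j * levelWeight g (2 * j)
          ≤ (8 * m * j / (n : ℝ) ^ 2) ^ j * (μ ^ 2 * (32 * (c : ℝ) ^ 2 / (j : ℝ) ^ 2) ^ j) :=
            mul_le_mul (edgeUnionProb_le_pow hmn hjm le_rfl)
              (levelWeight_two_mul_le hg0 hg1 hj1 hjc hμ) (levelWeight_nonneg _ _) (by positivity)
        _ = μ ^ 2 * (8 * m * j / (n : ℝ) ^ 2 * (32 * (c : ℝ) ^ 2 / (j : ℝ) ^ 2)) ^ j := by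
            rw [mul_pow]
            ring
        _ ≤ μ ^ 2 * (256 * γ ^ 2) ^ j := by gcongr
        _ = μ ^ 2 * (256 * γ ^ 2) * (256 * γ ^ 2) ^ (j - 1) := by
            rw [mul_assoc, ← pow_succ', Nat.sub_add_cancel hj1]
        _ ≤ _ := by gcongr
    refine (Finset.sum_le_sum hterm).trans ?_
    rw [← Finset.mul_sum]
    have hgeom : ∑ j ∈ (Finset.Icc 1 m).filter (· ≤ c), (1 / 2 : ℝ) ^ (j - 1) ≤ 2 := by
      calc ∑ j ∈ (Finset.Icc 1 m).filter (· ≤ c), (1 / 2 : ℝ) ^ (j - 1)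
          ≤ ∑ j ∈ Finset.Icc 1 m, (1 / 2 : ℝ) ^ (j - 1) :=
            Finset.sum_le_sum_of_subset_of_nonneg (Finset.filter_subset _ _)
              fun _ _ _ => by positivity
        _ = ∑ j ∈ Finset.range m, (1 / 2 : ℝ) ^ j := by
            rw [Finset.range_eq_Ico, Finset.sum_Ico_eq_sum_range, ← Finset.Ico_succ_right_eq_Icc,
              Finset.sum_Ico_eq_sum_range]
            simp
        _ ≤ 2 := by
            have := geom_sum_mul_neg (1 / 2 : ℝ) m
            have h2 : (0 : ℝ) ≤ (1 / 2) ^ m := by positivity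
            linarith
    calc μ ^ 2 * (256 * γ ^ 2) * ∑ j ∈ (Finset.Icc 1 m).filter (· ≤ c), (1 / 2 : ℝ) ^ (j - 1)
        ≤ μ ^ 2 * (256 * γ ^ 2) * 2 := by gcongr
      _ = (512 * γ) * γ * μ ^ 2 := by ring
      _ ≤ 16 * γ * μ ^ 2 := by
          gcongr
          linarith
  have hhigh : ∑ j ∈ (Finset.Icc 1 m).filter (¬ · ≤ c),
      edgeUnionProb n m j * levelWeight g (2 * j) ≤ 16 * γ * μ ^ 2 := by
    rcases Nat.lt_or_ge m c with hmc | hcm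
    · rw [Finset.filter_false_of_mem fun j hj => by simp at hj; omega, Finset.sum_empty]
      positivity
    · calc ∑ j ∈ (Finset.Icc 1 m).filter (¬ · ≤ c), edgeUnionProb n m j * levelWeight g (2 * j)
          ≤ ∑ j ∈ (Finset.Icc 1 m).filter (¬ · ≤ c), edgeUnionProb n m c * levelWeight g (2 * j) := by
            refine Finset.sum_le_sum fun j hj => ?_
            simp only [Finset.mem_filter, Finset.mem_Icc, not_le] at hj
            exact mul_le_mul_of_nonneg_right (edgeUnionProb_antitone hmn hj.2.le hj.1.2)
              (levelWeight_nonneg _ _)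
        _ ≤ (8 * m * c / (n : ℝ) ^ 2) ^ c * (μ * (μ * 2 ^ c)) := by
            rw [← Finset.mul_sum]
            refine mul_le_mul (edgeUnionProb_le_pow hmn hcm le_rfl) ?_
              (Finset.sum_nonneg fun _ _ => levelWeight_nonneg _ _) (by positivity)
            exact (sum_levelWeight_le hg0 hg1 _).trans (le_mul_of_one_le_right hμ0 hμ)
        _ = (16 * (m * c / (n : ℝ) ^ 2)) ^ c * μ ^ 2 := by
            rw [show 16 * (m * c / (n : ℝ) ^ 2) = 8 * m * c / (n : ℝ) ^ 2 * 2 by ring, mul_pow _ 2]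
            ring
        _ ≤ (16 * γ) ^ c * μ ^ 2 := by
            gcongr
            rw [div_le_iff₀ (by positivity)]
            refine le_of_sq_le_sq ?_ (by positivity)
            calc ((m : ℝ) * c) ^ 2 = (c ^ 2 * m) * m := by ring
              _ ≤ (γ ^ 2 * (n : ℝ) ^ 2) * (n : ℝ) ^ 2 := by
                  gcongr
                  have : (1 : ℝ) ≤ n := by exact_mod_cast hn
                  nlinarith
              _ = _ := by ring
        _ ≤ (16 * γ) ^ 1 * μ ^ 2 := by
            gcongr ?_ * _
            exact pow_le_pow_of_le_one (by positivity) (by linarith) hc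
        _ = _ := by ring
  linarith

end Estimates

/-! ### The classical lower bound. -/

theorem PMF.sum_toReal_eq_one {α : Type*} [Fintype α] (p : PMF α) : ∑ a, (p a).toReal = 1 := by
  have h := p.tsum_coe
  rw [tsum_fintype] at h
  rw [← ENNReal.toReal_sum fun a _ => p.apply_ne_top a, h, ENNReal.toReal_one]

theorem PMF.toReal_le_one {α : Type*} (p : PMF α) (a : α) : (p a).toReal ≤ 1 :=
  ENNReal.toReal_le_of_le_ofReal zero_le_one (by simpa using p.coe_le_one a)

theorem ClassicalOneWay.output_toReal {X Y : Type} {k : ℕ} (P : ClassicalOneWay X Y k) (x : X)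
    (y : Y) (b : Bool) : (P.output x y b).toReal
      = ∑ t, (P.message x t).toReal * (P.decide t y b).toReal := by
  rw [output, PMF.bind_apply, tsum_fintype, ENNReal.toReal_sum]
  · simp_rw [ENNReal.toReal_mul]
  · exact fun t _ => ENNReal.mul_ne_top (PMF.apply_ne_top _ _) (PMF.apply_ne_top _ _)

section Problem

variable {n m : ℕ}

theorem partialMatchingProblem_parities (x : Fin n → Bool) (M : PartialMatching n m) :
    partialMatchingProblem n m x (M, M.parities x) = some false := by
  simp [partialMatchingProblem]

theorem partialMatchingProblem_not_parities (hm : 0 < m) (x : Fin n → Bool)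
    (M : PartialMatching n m) :
    partialMatchingProblem n m x (M, fun l => !(M.parities x l)) = some true := by
  rw [partialMatchingProblem, if_neg, if_pos rfl]
  intro h
  have := congrFun h ⟨0, hm⟩
  simp at this

theorem eq_parities_of_partialMatchingProblem_eq_some {x : Fin n → Bool}
    {y : PartialMatching n m × (Fin m → Bool)} {b : Bool}
    (h : partialMatchingProblem n m x y = some b) :
    ∀ l, y.2 l = xor b (y.1.parities x l) := by
  intro l
  unfold partialMatchingProblem at h
  split_ifs at h with h1 h2
  · obtain rfl : false = b := by simpa using h
    simp [h1]
  · obtain rfl : true = b := by simpa using h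
    rw [h2]
    simp

/-- How much more likely Bob is to output `false` on `(M, w)` than on `(M, ¬w)`, given the
message `t`. -/
noncomputable def ClassicalOneWay.bias {X : Type} {k : ℕ}
    (P : ClassicalOneWay X (PartialMatching n m × (Fin m → Bool)) k) (t : Fin k → Bool)
    (M : PartialMatching n m) (w : Fin m → Bool) : ℝ :=
  (P.decide t (M, w) false).toReal - (P.decide t (M, fun l => !(w l)) false).toReal

variable {k : ℕ} {ε : ℝ} {P : ClassicalOneWay (Fin n → Bool) (PartialMatching n m × (Fin m → Bool)) k}

theorem ClassicalOneWay.abs_bias_le_one (t : Fin k → Bool) (M : PartialMatching n m)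
    (w : Fin m → Bool) : |P.bias t M w| ≤ 1 := by
  have h1 := PMF.toReal_le_one (P.decide t (M, w)) false
  have h2 := PMF.toReal_le_one (P.decide t (M, fun l => !(w l))) false
  have h3 : 0 ≤ (P.decide t (M, w) false).toReal := ENNReal.toReal_nonneg
  have h4 : 0 ≤ (P.decide t (M, fun l => !(w l)) false).toReal := ENNReal.toReal_nonneg
  rw [bias, abs_le]
  constructor <;> linarith

theorem ClassicalOneWay.bias_not (t : Fin k → Bool) (M : PartialMatching n m)
    (w : Fin m → Bool) : P.bias t M (fun l => !(w l)) = -P.bias t M w := by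
  simp [bias]

/-- Bob outputs `false` with probability at least `1 - ε` on the parity string and at most `ε` on
its complement. -/
theorem ClassicalOneWay.Computes.le_sum_mul_bias
    (hP : P.Computes (partialMatchingProblem n m) ε) (hm : 0 < m) (M : PartialMatching n m)
    (x : Fin n → Bool) :
    1 - 2 * ε ≤ ∑ t, (P.message x t).toReal * P.bias t M (M.parities x) := by
  have h1 := hP x _ _ (partialMatchingProblem_parities x M)
  have h2 := hP x _ _ (partialMatchingProblem_not_parities hm x M)
  have h3 := PMF.sum_toReal_eq_one (P.output x (M, fun l => !(M.parities x l)))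
  rw [Fintype.sum_bool] at h3
  rw [P.output_toReal] at h1
  have h4 := P.output_toReal x (M, fun l => !(M.parities x l)) false
  simp only [bias, mul_sub, Finset.sum_sub_distrib]
  linarith

/-- Two inputs with complementary parity strings require different answers for the same `M` and `w`,
but an empty message does not tell them apart. Positivity of `k` is what later allows `k + s ≤ k *
(1 + s)`. -/
theorem ClassicalOneWay.Computes.length_ne_zero
    (hP : P.Computes (partialMatchingProblem n m) ε) (hm : 0 < m) (hmn : 4 * m ≤ n)
    (hε : ε < 1 / 2) : k ≠ 0 := by
  rintro rfl
  let M : PartialMatching n m := PartialMatching.standard (by omega)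
  have hmsg : ∀ x x' t, P.message x t = P.message x' t := by
    intro x x' t
    have h : ∀ x, P.message x t = 1 := fun x => by
      rw [← (P.message x).tsum_coe, tsum_fintype, Fintype.sum_subsingleton _ t]
    rw [h, h]
  have hout : ∀ x x' y, P.output x y = P.output x' y := by
    intro x x' y
    unfold output
    rw [PMF.ext (hmsg x x')]
  let x₀ : Fin n → Bool := fun _ => false
  -- The indicator of the left endpoints of the standard matching; every edge has parity one.
  let x₁ : Fin n → Bool := fun i => Decidable.decide ((i : ℕ) < m)
  have hpar : ∀ l, M.parities x₀ l = !(M.parities x₁ l) := by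
    intro l
    simp [M, PartialMatching.parities, PartialMatching.standard, x₀, x₁]
  have h1 := hP x₀ _ _ (partialMatchingProblem_parities x₀ M)
  have h2 := hP x₁ _ _ (partialMatchingProblem_not_parities hm x₁ M)
  rw [← funext hpar, hout x₁ x₀] at h2
  have h3 := PMF.sum_toReal_eq_one (P.output x₀ (M, M.parities x₀))
  rw [Fintype.sum_bool] at h3
  linarith

/-- The contribution of one message `g`. If its mean is below `2 ^ (-c)`, the trivial bound by the
mass of `g` gives the second term. Otherwise Cauchy–Schwarz over `σ` and the averaged weight give
the first. -/
theorem sum_perm_sum_mul_le (hmn : 4 * m ≤ n) (hm : 0 < m) {c : ℕ} (hc : 0 < c) {γ : ℝ}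
    (hγ0 : 0 ≤ γ) (hγ : γ ≤ 1 / 32) (hcγ : (c : ℝ) ^ 2 * m ≤ γ ^ 2 * (n : ℝ) ^ 2)
    {g : (Fin n → Bool) → ℝ} (hg0 : ∀ x, 0 ≤ g x) (hg1 : ∀ x, g x ≤ 1)
    (M : PartialMatching n m) (h : PartialMatching n m → (Fin m → Bool) → ℝ)
    (hodd : ∀ M z, h M (fun l => !(z l)) = -h M z) (h1 : ∀ M z, |h M z| ≤ 1) :
    ∑ σ : Equiv.Perm (Fin n), ∑ x, g x * h (M.permute σ) ((M.permute σ).parities x)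
      ≤ (Fintype.card (Equiv.Perm (Fin n)) : ℝ)
        * (√(32 * γ) * ∑ x, g x + 2 ^ n * (1 / 2) ^ c) := by
  set N : ℝ := (Fintype.card (Equiv.Perm (Fin n)) : ℝ)
  have hmean : ∑ x, g x = 2 ^ n * walshCoeff g ∅ := by
    rw [walshCoeff, Fintype.card_fin, mul_div_cancel₀ _ (by positivity)]
    simp [walsh]
  have hG0 : 0 ≤ ∑ x, g x := Finset.sum_nonneg fun x _ => hg0 x
  rcases lt_or_ge (walshCoeff g ∅ * 2 ^ c) 1 with hlight | hheavy
  · have hle : ∀ σ : Equiv.Perm (Fin n),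
        ∑ x, g x * h (M.permute σ) ((M.permute σ).parities x) ≤ ∑ x, g x := fun σ =>
      Finset.sum_le_sum fun x _ =>
        mul_le_of_le_one_right (hg0 x) ((le_abs_self _).trans (h1 _ _))
    calc _ ≤ ∑ _σ : Equiv.Perm (Fin n), ∑ x, g x := Finset.sum_le_sum fun σ _ => hle σ
      _ = N * ∑ x, g x := by rw [Finset.sum_const, nsmul_eq_mul, Finset.card_univ]
      _ ≤ N * (√(32 * γ) * ∑ x, g x + 2 ^ n * (1 / 2) ^ c) := by
          gcongr
          have : ∑ x, g x ≤ 2 ^ n * (1 / 2) ^ c := by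
            rw [hmean]
            gcongr
            rw [one_div, inv_pow, ← one_div, le_div_iff₀ (by positivity)]
            exact hlight.le
          have h0 : 0 ≤ √(32 * γ) * ∑ x, g x := by positivity
          linarith
  · have hsq : (∑ σ : Equiv.Perm (Fin n),
        ∑ x, g x * h (M.permute σ) ((M.permute σ).parities x)) ^ 2
        ≤ (N * (√(32 * γ) * ∑ x, g x)) ^ 2 := by
      calc _ ≤ N * ∑ σ : Equiv.Perm (Fin n),
              (∑ x, g x * h (M.permute σ) ((M.permute σ).parities x)) ^ 2 := by
            have := sq_sum_le_card_mul_sum_sq (s := (Finset.univ : Finset (Equiv.Perm (Fin n))))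
              (f := fun σ => ∑ x, g x * h (M.permute σ) ((M.permute σ).parities x))
            rwa [Finset.card_univ] at this
        _ ≤ N * ∑ σ : Equiv.Perm (Fin n), (2 ^ n) ^ 2 * (M.permute σ).weight g := by
            gcongr with σ
            exact (M.permute σ).sq_sum_mul_parities_le g _ (hodd _) (h1 _)
        _ = N * ((2 ^ n) ^ 2 * (N * ∑ j ∈ Finset.Icc 1 m,
              edgeUnionProb n m j * levelWeight g (2 * j))) := by
            rw [← Finset.mul_sum, M.sum_weight_permute (by omega)]
            rfl
        _ ≤ N * ((2 ^ n) ^ 2 * (N * (32 * γ * walshCoeff g ∅ ^ 2))) := by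
            gcongr
            exact sum_edgeUnionProb_mul_levelWeight_le hg0 hg1 (by omega) hmn hc hheavy hγ0 hγ hcγ
        _ = _ := by
            rw [hmean, mul_pow, mul_pow, Real.sq_sqrt (by positivity)]
            ring
    refine (le_of_sq_le_sq hsq (by positivity)).trans ?_
    gcongr
    have : (0 : ℝ) ≤ 2 ^ n * (1 / 2) ^ c := by positivity
    linarith

/-- Average the advantage over `x` and `σ`, then sum over messages with threshold `c = k + s`: the
masses add up to `2 ^ n`, and the `2 ^ k` error terms to `2 ^ n * 2 ^ (-s)`. -/
theorem ClassicalOneWay.Computes.one_sub_le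
    (hP : P.Computes (partialMatchingProblem n m) ε) (hmn : 4 * m ≤ n) (hm : 0 < m) {s : ℕ}
    (hk : 0 < k + s) {γ : ℝ} (hγ0 : 0 ≤ γ) (hγ : γ ≤ 1 / 32)
    (hcγ : ((k + s : ℕ) : ℝ) ^ 2 * m ≤ γ ^ 2 * (n : ℝ) ^ 2) :
    1 - 2 * ε ≤ √(32 * γ) + (1 / 2) ^ s := by
  let M : PartialMatching n m := PartialMatching.standard (by omega)
  set N : ℝ := (Fintype.card (Equiv.Perm (Fin n)) : ℝ)
  have hN : 0 < N := by
    simp only [N]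
    exact_mod_cast Fintype.card_pos
  have hpos : (0 : ℝ) < N * 2 ^ n := by positivity
  refine le_of_mul_le_mul_left ?_ hpos
  calc N * 2 ^ n * (1 - 2 * ε)
      = ∑ _σ : Equiv.Perm (Fin n), ∑ _x : Fin n → Bool, (1 - 2 * ε) := by
        simp only [Finset.sum_const, nsmul_eq_mul, Finset.card_univ, Fintype.card_pi,
          Fintype.card_bool, Finset.prod_const, Fintype.card_fin, N]
        push_cast
        ring
    _ ≤ ∑ σ : Equiv.Perm (Fin n), ∑ x, ∑ t,
          (P.message x t).toReal * P.bias t (M.permute σ) ((M.permute σ).parities x) :=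
        Finset.sum_le_sum fun σ _ => Finset.sum_le_sum fun x _ => hP.le_sum_mul_bias hm _ x
    _ = ∑ t, ∑ σ : Equiv.Perm (Fin n), ∑ x,
          (P.message x t).toReal * P.bias t (M.permute σ) ((M.permute σ).parities x) :=
        (Finset.sum_congr rfl fun σ _ => Finset.sum_comm).trans Finset.sum_comm
    _ ≤ ∑ t, N * (√(32 * γ) * ∑ x, (P.message x t).toReal + 2 ^ n * (1 / 2) ^ (k + s)) :=
        Finset.sum_le_sum fun t _ => sum_perm_sum_mul_le hmn hm hk hγ0 hγ hcγ
          (fun x => ENNReal.toReal_nonneg) (fun x => PMF.toReal_le_one _ _) M (P.bias t)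
          (P.bias_not t) (P.abs_bias_le_one t)
    _ = N * 2 ^ n * (√(32 * γ) + (1 / 2) ^ s) := by
        rw [← Finset.mul_sum, Finset.sum_add_distrib, ← Finset.mul_sum, Finset.sum_comm]
        simp_rw [PMF.sum_toReal_eq_one]
        simp only [Finset.sum_const, nsmul_eq_mul, Finset.card_univ, Fintype.card_pi,
          Fintype.card_bool, Finset.prod_const, Fintype.card_fin]
        push_cast
        have : (2 : ℝ) ^ k * (1 / 2) ^ k = 1 := by rw [← mul_pow]; norm_num
        rw [pow_add]
        linear_combination (N * 2 ^ n * (1 / 2) ^ s) * this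

end Problem

/-- The lower bound on the length of a classical one-way protocol for Partial Matching. -/
theorem exists_classical_lower_bound {ε : ℝ} (hε : ε < 1 / 2) :
    ∃ c : ℝ, 0 < c ∧ ∀ {n m k : ℕ}
      {P : ClassicalOneWay (Fin n → Bool) (PartialMatching n m × (Fin m → Bool)) k},
      0 < m → 4 * m ≤ n → P.Computes (partialMatchingProblem n m) ε →
        c * (n / √m) ≤ k := by
  have hδ : 0 < 1 - 2 * ε := by linarith
  -- The gap `1 - 2 * ε` is halved between `2 ^ (-s)` and `√(32 * γ)`; strictness here yields the
  -- final contradiction.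
  obtain ⟨s, hs⟩ := exists_pow_lt_of_lt_one (half_pos hδ) (by norm_num : (1 / 2 : ℝ) < 1)
  obtain ⟨γ, hγ0, hγ, hγs⟩ : ∃ γ : ℝ, 0 < γ ∧ γ ≤ 1 / 32 ∧ √(32 * γ) ≤ (1 - 2 * ε) / 2 := by
    refine ⟨min (1 / 32) (((1 - 2 * ε) / 2) ^ 2 / 32), by positivity, min_le_left _ _, ?_⟩
    refine Real.sqrt_le_iff.mpr ⟨by positivity, ?_⟩
    have := min_le_right (1 / 32 : ℝ) (((1 - 2 * ε) / 2) ^ 2 / 32)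
    linarith
  refine ⟨γ / (1 + s), by positivity, ?_⟩
  intro n m k P hm hmn hP
  have hk : 0 < k := Nat.pos_of_ne_zero (hP.length_ne_zero hm hmn hε)
  by_contra! hlt
  have hsm : 0 < √(m : ℝ) := Real.sqrt_pos.mpr (by exact_mod_cast hm)
  have hk1 : (1 : ℝ) ≤ k := by exact_mod_cast hk
  have hle : ((k + s : ℕ) : ℝ) * √m ≤ γ * n := by
    have h1 : ((k + s : ℕ) : ℝ) ≤ k * (1 + s) := by
      push_cast
      nlinarith [show (0 : ℝ) ≤ s by positivity]
    have h2 : k * (1 + (s : ℝ)) < γ * (n / √m) := by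
      rw [div_mul_eq_mul_div, lt_div_iff₀ (by positivity)] at hlt
      exact hlt
    calc ((k + s : ℕ) : ℝ) * √m ≤ γ * (n / √m) * √m := by gcongr; exact h1.trans h2.le
      _ = γ * n := by field_simp
  have hsq : ((k + s : ℕ) : ℝ) ^ 2 * m ≤ γ ^ 2 * (n : ℝ) ^ 2 := by
    calc ((k + s : ℕ) : ℝ) ^ 2 * m = (((k + s : ℕ) : ℝ) * √m) ^ 2 := by
          rw [mul_pow, Real.sq_sqrt (by positivity)]
      _ ≤ (γ * n) ^ 2 := by gcongr
      _ = _ := by ring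
  have := hP.one_sub_le hmn hm (by omega) hγ0.le hγ hsq
  linarith

/-! ### Protocols in which Alice's random seed is part of the message. -/

section PublicCoin

theorem exists_classicalOneWay_of_seeds {X Y Ω T : Type} [Fintype Ω] [Nonempty Ω] [Fintype T]
    {k : ℕ} (hT : Fintype.card T ≤ 2 ^ k) (send : Ω → X → T) (out : T → Y → Bool)
    {f : PartialBoolFun X Y} {ε : ℝ}
    (h : ∀ x y b, f x y = some b →
      ((Finset.univ.filter fun a => out (send a x) y ≠ b).card : ℝ) ≤ ε * Fintype.card Ω) :
    ∃ P : ClassicalOneWay X Y k, P.Computes f ε := by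
  classical
  obtain ⟨e⟩ : Nonempty (T ↪ (Fin k → Bool)) :=
    Function.Embedding.nonempty_of_card_le (by simpa using hT)
  have hT0 : ∀ _ : X, Nonempty T := fun x => ⟨send (Classical.arbitrary Ω) x⟩
  refine ⟨⟨fun x => (PMF.uniformOfFintype Ω).map fun a => e (send a x), fun t y =>
    -- The value `false` off the range of `e` is immaterial, since Alice never sends such a message.
    PMF.pure (if ht : ∃ c, e c = t then out ht.choose y else false)⟩, ?_⟩
  intro x y b hxy
  have hdec : ∀ c : T, (if ht : ∃ c', e c' = e c then out ht.choose y else false) = out c y := by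
    intro c
    have hex : ∃ c', e c' = e c := ⟨c, rfl⟩
    rw [dif_pos hex, e.injective hex.choose_spec]
  have hcard : (0 : ℝ) < Fintype.card Ω := by exact_mod_cast Fintype.card_pos
  rw [ClassicalOneWay.output, PMF.bind_map]
  simp only [Function.comp_def, hdec, PMF.bind_apply, PMF.uniformOfFintype_apply, PMF.pure_apply,
    tsum_fintype, mul_ite, mul_one, mul_zero]
  rw [← Finset.sum_filter, Finset.sum_const, nsmul_eq_mul, ENNReal.toReal_mul, ENNReal.toReal_inv,
    ENNReal.toReal_natCast, ENNReal.toReal_natCast, ← div_eq_mul_inv, le_div_iff₀ hcard]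
  have h1 := h x y b hxy
  have h2 := Finset.card_filter_add_card_filter_not (s := (Finset.univ : Finset Ω))
    fun a => out (send a x) y = b
  rw [Finset.card_univ] at h2
  have h3 : ((Finset.univ.filter fun a => out (send a x) y = b).card : ℝ)
      + ((Finset.univ.filter fun a => ¬out (send a x) y = b).card : ℝ) = Fintype.card Ω := by
    exact_mod_cast h2
  simp_rw [eq_comm (a := b)]
  simp only [ne_eq] at h1
  linarith

variable {n m : ℕ}

/-- Once a single edge lies inside the transmitted set, comparing its parity with `w` there reveals
the value without error. Seeds whose set contains no edge are counted as failures. -/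
theorem exists_classicalOneWay_of_finsets {Ω : Type} [Fintype Ω] [Nonempty Ω]
    (S : Ω → Finset (Fin n)) {k c : ℕ} (hc : ∀ a, (S a).card ≤ c)
    (hk : Fintype.card Ω * 2 ^ c ≤ 2 ^ k) {ε : ℝ}
    (h : ∀ M : PartialMatching n m,
      ((Finset.univ.filter fun a => ∀ l, ¬(M.left l ∈ S a ∧ M.right l ∈ S a)).card : ℝ)
        ≤ ε * Fintype.card Ω) :
    ∃ P : ClassicalOneWay (Fin n → Bool) (PartialMatching n m × (Fin m → Bool)) k,
      P.Computes (partialMatchingProblem n m) ε := by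
  classical
  let T := Σ a : Ω, ({i // i ∈ S a} → Bool)
  have hT : Fintype.card T ≤ 2 ^ k := by
    refine le_trans ?_ hk
    rw [Fintype.card_sigma, ← smul_eq_mul, ← Finset.card_univ, ← Finset.sum_const]
    refine Finset.sum_le_sum fun a _ => ?_
    simpa using Nat.pow_le_pow_right two_pos (hc a)
  refine exists_classicalOneWay_of_seeds hT (fun a x => ⟨a, fun i => x i⟩)
    (fun t y => if ht : ∃ l, y.1.left l ∈ S t.1 ∧ y.1.right l ∈ S t.1 then
      xor (y.2 ht.choose) (xor (t.2 ⟨_, ht.choose_spec.1⟩) (t.2 ⟨_, ht.choose_spec.2⟩))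
      else false) ?_
  intro x y b hxy
  refine le_trans ?_ (h y.1)
  refine Nat.cast_le.mpr (Finset.card_le_card ?_)
  intro a ha
  rw [Finset.mem_filter] at ha ⊢
  refine ⟨Finset.mem_univ _, fun l hl => ha.2 ?_⟩
  have hex : ∃ l, y.1.left l ∈ S a ∧ y.1.right l ∈ S a := ⟨l, hl⟩
  have hspec := eq_parities_of_partialMatchingProblem_eq_some hxy hex.choose
  simp only [dif_pos hex]
  rw [hspec, PartialMatching.parities]
  simp

end PublicCoin

/-! ### A 4-wise independent random set: first and second moments. -/

section CubicHash

variable {K : Type} [Field K] [Fintype K] [DecidableEq K]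

/-- The values of the cubic polynomials over `K`, a 4-wise independent family of functions. -/
def cubicHash (a : Fin 4 → K) (u : K) : K := ∑ k : Fin 4, u ^ (k : ℕ) * a k

/-- Evaluation at four distinct points is an invertible Vandermonde map, so the four values are
jointly uniform. -/
theorem card_filter_cubicHash {u : Fin 4 → K} (hu : Function.Injective u) (A : Fin 4 → Finset K) :
    (Finset.univ.filter fun a => ∀ k, cubicHash a (u k) ∈ A k).card = ∏ k, (A k).card := by
  rw [← Fintype.card_piFinset]
  have hV : IsUnit (Matrix.vandermonde u) := by
    rw [Matrix.isUnit_iff_isUnit_det, isUnit_iff_ne_zero]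
    exact Matrix.det_vandermonde_ne_zero_iff.mpr hu
  have hbij : Function.Bijective (Matrix.vandermonde u).mulVec :=
    ⟨Matrix.mulVec_injective_iff_isUnit.mpr hV, Matrix.mulVec_surjective_iff_isUnit.mpr hV⟩
  refine Finset.card_equiv (Equiv.ofBijective _ hbij) fun a => ?_
  simp only [Finset.mem_filter, Finset.mem_univ, true_and, Fintype.mem_piFinset,
    Equiv.ofBijective_apply]
  rfl

variable {n m : ℕ} (ι : Fin n ↪ K) (B : Finset K)

/-- The random set of vertices that the hash function with coefficients `a` maps to `B`. -/
def hashSet (a : Fin 4 → K) : Finset (Fin n) := Finset.univ.filter fun i => cubicHash a (ι i) ∈ B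

/-- The number of edges of `M` with both endpoints in the random set. -/
def hashEdges (M : PartialMatching n m) (a : Fin 4 → K) : ℕ :=
  (Finset.univ.filter fun l => M.left l ∈ hashSet ι B a ∧ M.right l ∈ hashSet ι B a).card

/-- Padding to four points lets `card_filter_cubicHash` also count events about one or two vertices,
with no constraint on the others. -/
theorem exists_injective_fin_four (hn : 4 ≤ n) {i j : Fin n} (hij : i ≠ j) :
    ∃ u : Fin 4 → Fin n, Function.Injective u ∧ u 0 = i ∧ u 1 = j := by
  obtain ⟨k, hk, l, hl, hkl⟩ := Finset.one_lt_card.mp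
    (show 1 < (({i, j} : Finset (Fin n))ᶜ).card by
      rw [Finset.card_compl, Finset.card_pair hij, Fintype.card_fin]
      omega)
  simp only [Finset.mem_compl, Finset.mem_insert, Finset.mem_singleton, not_or] at hk hl
  refine ⟨![i, j, k, l], ?_, rfl, rfl⟩
  intro a b hab
  fin_cases a <;> fin_cases b <;> simp_all [eq_comm]

theorem card_filter_mem_hashSet_pair (hn : 4 ≤ n) {i j : Fin n} (hij : i ≠ j) :
    (Finset.univ.filter fun a => i ∈ hashSet ι B a ∧ j ∈ hashSet ι B a).card
      = B.card ^ 2 * Fintype.card K ^ 2 := by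
  obtain ⟨u, hu, rfl, rfl⟩ := exists_injective_fin_four hn hij
  have h := card_filter_cubicHash (ι.injective.comp hu) ![B, B, Finset.univ, Finset.univ]
  simp only [Fin.forall_fin_succ, Fin.prod_univ_four] at h
  simp at h
  simp only [hashSet, Finset.mem_filter, Finset.mem_univ, true_and]
  rw [h]
  ring

theorem card_filter_mem_hashSet (hn : 4 ≤ n) (i : Fin n) :
    (Finset.univ.filter fun a => i ∈ hashSet ι B a).card = B.card * Fintype.card K ^ 3 := by
  obtain ⟨j, hj⟩ : ∃ j, i ≠ j := by
    have : Nontrivial (Fin n) := Fin.nontrivial_iff_two_le.mpr (by omega)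
    obtain ⟨j, hj⟩ := exists_ne i
    exact ⟨j, hj.symm⟩
  obtain ⟨u, hu, rfl, rfl⟩ := exists_injective_fin_four hn hj
  have h := card_filter_cubicHash (ι.injective.comp hu) ![B, Finset.univ, Finset.univ, Finset.univ]
  simp only [Fin.forall_fin_succ, Fin.prod_univ_four] at h
  simp at h
  simp only [hashSet, Finset.mem_filter, Finset.mem_univ, true_and]
  rw [h]
  ring

theorem card_filter_two_edges (M : PartialMatching n m) {l l' : Fin m} (hl : l ≠ l') :
    (Finset.univ.filter fun a => (M.left l ∈ hashSet ι B a ∧ M.right l ∈ hashSet ι B a)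
      ∧ M.left l' ∈ hashSet ι B a ∧ M.right l' ∈ hashSet ι B a).card = B.card ^ 4 := by
  have hu : Function.Injective ![M.left l, M.right l, M.left l', M.right l'] := by
    have h1 := M.left_ne_right
    have h2 : M.left l ≠ M.left l' := fun h => hl (M.left_injective h)
    have h3 : M.right l ≠ M.right l' := fun h => hl (M.right_injective h)
    have h4 : ∀ a b, M.right b ≠ M.left a := fun a b => (M.left_ne_right a b).symm
    intro a b hab
    fin_cases a <;> fin_cases b <;> simp_all [eq_comm]
  have h := card_filter_cubicHash (ι.injective.comp hu) fun _ => B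
  simp only [Fin.forall_fin_succ, Fin.prod_univ_four] at h
  simp at h
  simp only [hashSet, Finset.mem_filter, Finset.mem_univ, true_and]
  simp_rw [and_assoc]
  rw [h]
  ring

theorem sum_hashEdges (hn : 4 ≤ n) (M : PartialMatching n m) :
    ∑ a, hashEdges ι B M a = m * (B.card ^ 2 * Fintype.card K ^ 2) := by
  simp only [hashEdges, Finset.card_filter]
  rw [Finset.sum_comm]
  simp_rw [← Finset.card_filter]
  rw [Finset.sum_congr rfl fun l _ =>
    card_filter_mem_hashSet_pair ι B hn (M.left_ne_right l l)]
  simp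

theorem sum_hashEdges_sq_le (hn : 4 ≤ n) (M : PartialMatching n m) :
    ∑ a, hashEdges ι B M a ^ 2
      ≤ m * (B.card ^ 2 * Fintype.card K ^ 2) + m ^ 2 * B.card ^ 4 := by
  have h1 : ∀ a, hashEdges ι B M a ^ 2 = ∑ l, ∑ l',
      if (M.left l ∈ hashSet ι B a ∧ M.right l ∈ hashSet ι B a)
        ∧ M.left l' ∈ hashSet ι B a ∧ M.right l' ∈ hashSet ι B a then 1 else 0 := by
    intro a
    rw [hashEdges, sq, Finset.card_filter, Finset.sum_mul_sum]
    refine Finset.sum_congr rfl fun l _ => Finset.sum_congr rfl fun l' _ => ?_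
    rw [ite_zero_mul_ite_zero, one_mul]
  simp_rw [h1]
  rw [(Finset.sum_comm.trans (Finset.sum_congr rfl fun l _ => Finset.sum_comm) :
    ∑ a : Fin 4 → K, ∑ l : Fin m, ∑ l' : Fin m, (if (M.left l ∈ hashSet ι B a
      ∧ M.right l ∈ hashSet ι B a) ∧ M.left l' ∈ hashSet ι B a ∧ M.right l' ∈ hashSet ι B a
      then 1 else 0) = _)]
  simp_rw [← Finset.card_filter]
  calc _ ≤ ∑ l : Fin m, ∑ l' : Fin m,
        ((if l' = l then B.card ^ 2 * Fintype.card K ^ 2 else 0) + B.card ^ 4) := by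
        refine Finset.sum_le_sum fun l _ => Finset.sum_le_sum fun l' _ => ?_
        split_ifs with h
        · subst h
          simp only [and_self]
          rw [card_filter_mem_hashSet_pair ι B hn (M.left_ne_right l' l')]
          omega
        · rw [card_filter_two_edges ι B M fun h' => h h'.symm, zero_add]
    _ = _ := by
        simp [Finset.sum_add_distrib]
        ring

/-- Chebyshev's inequality in counting form. Distinct edges are captured independently, so the
variance is at most the mean, `m * b ^ 2 / p ^ 2`. -/
theorem card_hashEdges_eq_zero_mul_le (hn : 4 ≤ n) (hm : 0 < m) (hB : B.Nonempty)
    (M : PartialMatching n m) :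
    ((Finset.univ.filter fun a => hashEdges ι B M a = 0).card : ℝ) * (m * (B.card : ℝ) ^ 2)
      ≤ (Fintype.card K : ℝ) ^ 6 := by
  set b : ℝ := (B.card : ℝ)
  set p : ℝ := (Fintype.card K : ℝ)
  have hb : 0 < b := by simpa [b] using hB
  have hmr : (0 : ℝ) < m := by exact_mod_cast hm
  have e1 : ∑ a, (hashEdges ι B M a : ℝ) = m * (b ^ 2 * p ^ 2) := by
    simp only [b, p]
    exact_mod_cast sum_hashEdges ι B hn M
  have e2 : ∑ a, (hashEdges ι B M a : ℝ) ^ 2 ≤ m * (b ^ 2 * p ^ 2) + (m : ℝ) ^ 2 * b ^ 4 := by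
    simp only [b, p]
    exact_mod_cast sum_hashEdges_sq_le ι B hn M
  have e3 : ∑ _a : Fin 4 → K, ((m : ℝ) * b ^ 2) ^ 2 = p ^ 4 * ((m : ℝ) * b ^ 2) ^ 2 := by
    simp [p]
  have h1 : ((Finset.univ.filter fun a => hashEdges ι B M a = 0).card : ℝ) * (m * b ^ 2) ^ 2
      ≤ ∑ a, ((hashEdges ι B M a : ℝ) * p ^ 2 - m * b ^ 2) ^ 2 := by
    rw [← nsmul_eq_mul, ← Finset.sum_const]
    refine le_trans (Finset.sum_le_sum fun a ha => ?_)
      (Finset.sum_le_sum_of_subset_of_nonneg (Finset.filter_subset _ _) fun _ _ _ => sq_nonneg _)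
    rw [(Finset.mem_filter.mp ha).2]
    simp
  have h2 : ∑ a, ((hashEdges ι B M a : ℝ) * p ^ 2 - m * b ^ 2) ^ 2
      = p ^ 4 * ∑ a, (hashEdges ι B M a : ℝ) ^ 2
        - 2 * p ^ 2 * (m * b ^ 2) * ∑ a, (hashEdges ι B M a : ℝ)
        + ∑ _a : Fin 4 → K, ((m : ℝ) * b ^ 2) ^ 2 := by
    rw [Finset.mul_sum, Finset.mul_sum, ← Finset.sum_sub_distrib, ← Finset.sum_add_distrib]
    refine Finset.sum_congr rfl fun a _ => ?_
    ring
  have h3 : p ^ 4 * ∑ a, (hashEdges ι B M a : ℝ) ^ 2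
      ≤ p ^ 4 * (m * (b ^ 2 * p ^ 2) + (m : ℝ) ^ 2 * b ^ 4) := by gcongr
  refine le_of_mul_le_mul_right ?_ (show (0 : ℝ) < m * b ^ 2 by positivity)
  rw [h2, e1, e3] at h1
  linarith

/-- Markov's inequality in counting form. -/
theorem card_lt_hashSet_mul_le (hn : 4 ≤ n) (c : ℕ) :
    (Finset.univ.filter fun a => c < (hashSet ι B a).card).card * c
      ≤ n * (B.card * Fintype.card K ^ 3) := by
  have h : ∑ a, (hashSet ι B a).card = n * (B.card * Fintype.card K ^ 3) := by
    have h1 : ∀ a, (hashSet ι B a).card = ∑ i, if i ∈ hashSet ι B a then 1 else 0 := by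
      simp
    simp_rw [h1]
    rw [Finset.sum_comm]
    simp_rw [← Finset.card_filter]
    rw [Finset.sum_congr rfl fun i _ => card_filter_mem_hashSet ι B hn i]
    simp
  rw [← h, ← smul_eq_mul, ← Finset.sum_const]
  exact (Finset.sum_le_sum fun a ha => (Finset.mem_filter.mp ha).2.le).trans
    (Finset.sum_le_sum_of_subset (Finset.filter_subset _ _))

end CubicHash

/-! ### The classical upper bound. -/

theorem one_le_div_sqrt {n m : ℕ} (hm : 0 < m) (hmn : 4 * m ≤ n) : 1 ≤ (n : ℝ) / √m := by
  have hsm : 0 < √(m : ℝ) := Real.sqrt_pos.mpr (by exact_mod_cast hm)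
  rw [one_le_div hsm, Real.sqrt_le_iff]
  have h1 : (m : ℝ) ≤ n := by exact_mod_cast (by omega : m ≤ n)
  have h2 : (1 : ℝ) ≤ n := by exact_mod_cast (by omega : 1 ≤ n)
  exact ⟨by positivity, by nlinarith⟩

theorem sqrt_le_div_sqrt {n m : ℕ} (hm : 0 < m) (hmn : 4 * m ≤ n) : √(n : ℝ) ≤ n / √m := by
  have hsm : 0 < √(m : ℝ) := Real.sqrt_pos.mpr (by exact_mod_cast hm)
  rw [le_div_iff₀ hsm]
  have h1 : (m : ℝ) ≤ n := by exact_mod_cast (by omega : m ≤ n)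
  calc √(n : ℝ) * √m ≤ √n * √n := by gcongr
    _ = n := Real.mul_self_sqrt (by positivity)

/-- A classical one-way protocol for Partial Matching in which Alice sends her bits on a random
set. -/
theorem exists_classical_upper_bound {ε : ℝ} (hε : 0 < ε) :
    ∃ C : ℝ, 0 < C ∧ ∀ {n m : ℕ}, 0 < m → 4 * m ≤ n →
      ∃ (k : ℕ) (P : ClassicalOneWay (Fin n → Bool) (PartialMatching n m × (Fin m → Bool)) k),
        P.Computes (partialMatchingProblem n m) ε ∧ (k : ℝ) ≤ C * (n / √m) := by
  set A : ℝ := √(2 / ε) with hA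
  have hA0 : 0 < A := Real.sqrt_pos.mpr (by positivity)
  -- With `X = n / √m ≥ 1`, the seed costs at most `8 * (X + 1) + 4 ≤ 20 * X` bits, and rounding up
  -- `c` costs one more `X`.
  refine ⟨21 + 2 / ε * (A + 1), by positivity, ?_⟩
  intro n m hm hmn
  have hX1 := one_le_div_sqrt hm hmn
  have hXs := sqrt_le_div_sqrt hm hmn
  set X : ℝ := (n : ℝ) / √m with hX
  have hmr : (0 : ℝ) < m := by exact_mod_cast hm
  have hsm : 0 < √(m : ℝ) := Real.sqrt_pos.mpr hmr
  obtain ⟨p, hp, hnp, hp2⟩ := Nat.exists_prime_lt_and_le_two_mul n (by omega)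
  have : Fact p.Prime := ⟨hp⟩
  have hpr : (0 : ℝ) < p := by exact_mod_cast hp.pos
  have hnpr : (n : ℝ) ≤ p := by exact_mod_cast hnp.le
  have hK : Fintype.card (ZMod p) = p := ZMod.card p
  obtain ⟨ι⟩ : Nonempty (Fin n ↪ ZMod p) :=
    Function.Embedding.nonempty_of_card_le (by simpa using hnp.le)
  -- Density about `A / √m` makes the probability of catching no edge at most `1 / A ^ 2 = ε / 2`.
  -- If the minimum is `p`, the set is everything and no edge is missed.
  set b : ℕ := min p ⌈(p : ℝ) * A / √m⌉₊ with hb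
  have hb0 : 0 < b := lt_min hp.pos (Nat.ceil_pos.mpr (by positivity))
  obtain ⟨B, -, hB⟩ := Finset.exists_subset_card_eq
    (show b ≤ (Finset.univ : Finset (ZMod p)).card by simp [hb])
  have hBne : B.Nonempty := Finset.card_pos.mp (hB ▸ hb0)
  have hbr : (0 : ℝ) < b := by exact_mod_cast hb0
  -- This is `2 / ε` times the expected size `n * b / p`, so Markov leaves probability `ε / 2` for a
  -- larger set.
  set c : ℕ := ⌈2 * n * b / (p * ε)⌉₊ with hc
  have hnr : (0 : ℝ) < n := by exact_mod_cast (by omega : 0 < n)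
  have hc0 : 0 < c := Nat.ceil_pos.mpr (by positivity)
  have hcr : (0 : ℝ) < c := by exact_mod_cast hc0
  have hmiss : ∀ M : PartialMatching n m,
      ((Finset.univ.filter fun a => hashEdges ι B M a = 0).card : ℝ) ≤ ε / 2 * (p : ℝ) ^ 4 := by
    intro M
    rcases min_choice p ⌈(p : ℝ) * A / √m⌉₊ with h | h
    · have hBu : B = Finset.univ := Finset.eq_univ_of_card B (by rw [hB, hb, h, hK])
      rw [Finset.filter_false_of_mem fun a _ => by simp [hashEdges, hashSet, hBu, hm.ne']]
      simp only [Finset.card_empty, Nat.cast_zero]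
      positivity
    · have h1 := card_hashEdges_eq_zero_mul_le ι B (by omega) hm hBne M
      rw [hB, hK] at h1
      have h2 : (p : ℝ) * A / √m ≤ b := by
        rw [hb, h]
        exact Nat.le_ceil _
      have h3 : 2 * (p : ℝ) ^ 2 / ε ≤ m * (b : ℝ) ^ 2 := by
        calc 2 * (p : ℝ) ^ 2 / ε = m * ((p : ℝ) * A / √m) ^ 2 := by
              rw [div_pow, mul_pow, hA, Real.sq_sqrt (by positivity), Real.sq_sqrt hmr.le]
              field_simp
          _ ≤ _ := by gcongr
      have h4 := (mul_le_mul_of_nonneg_left h3 (Nat.cast_nonneg _)).trans h1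
      refine le_of_mul_le_mul_right (h4.trans (le_of_eq ?_))
        (show (0 : ℝ) < 2 * (p : ℝ) ^ 2 / ε by positivity)
      field_simp
  have hlarge : ((Finset.univ.filter fun a => c < (hashSet ι B a).card).card : ℝ)
      ≤ ε / 2 * (p : ℝ) ^ 4 := by
    have h1 := card_lt_hashSet_mul_le ι B (by omega) c
    rw [hB, hK] at h1
    have h1' : ((Finset.univ.filter fun a => c < (hashSet ι B a).card).card : ℝ) * c
        ≤ n * (b * (p : ℝ) ^ 3) := by exact_mod_cast h1
    have h2 : 2 * n * b / (p * ε) ≤ (c : ℝ) := Nat.le_ceil _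
    refine le_of_mul_le_mul_right (h1'.trans ?_) hcr
    calc (n : ℝ) * (b * (p : ℝ) ^ 3) = ε / 2 * (p : ℝ) ^ 4 * (2 * n * b / (p * ε)) := by
          field_simp
      _ ≤ _ := by gcongr
  -- The seed needs only `O(log n)` bits, but the crude bound `O(√n)` is enough because `√n ≤ n /
  -- √m`.
  set r : ℕ := Nat.sqrt n + 1 with hr
  have hnr2 : n ≤ 2 ^ (2 * r) := by
    calc n ≤ r ^ 2 := (Nat.lt_succ_sqrt' n).le
      _ ≤ (2 ^ r) ^ 2 := Nat.pow_le_pow_left Nat.lt_two_pow_self.le 2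
      _ = 2 ^ (2 * r) := by rw [← pow_mul, mul_comm]
  have hseeds : Fintype.card (Fin 4 → ZMod p) * 2 ^ c ≤ 2 ^ (4 * (2 * r + 1) + c) := by
    rw [pow_add]
    refine Nat.mul_le_mul_right _ ?_
    calc Fintype.card (Fin 4 → ZMod p) = p ^ 4 := by simp
      _ ≤ (2 ^ (2 * r + 1)) ^ 4 := by
          refine Nat.pow_le_pow_left ?_ 4
          rw [pow_succ]
          omega
      _ = _ := by rw [← pow_mul, mul_comm]
  obtain ⟨P, hP⟩ := exists_classicalOneWay_of_finsets (m := m) (ε := ε)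
    -- An oversized set is replaced by the empty one, which keeps the message length bounded and
    -- counts as a failure.
    (fun a => if (hashSet ι B a).card ≤ c then hashSet ι B a else ∅)
    (fun a => by split_ifs with h <;> simp [h]) hseeds fun M => by
      have hsub : (Finset.univ.filter fun a : Fin 4 → ZMod p => ∀ l,
          ¬(M.left l ∈ (if (hashSet ι B a).card ≤ c then hashSet ι B a else ∅)
            ∧ M.right l ∈ (if (hashSet ι B a).card ≤ c then hashSet ι B a else ∅)))
          ⊆ (Finset.univ.filter fun a => hashEdges ι B M a = 0)
            ∪ Finset.univ.filter fun a => c < (hashSet ι B a).card := by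
        intro a ha
        simp only [Finset.mem_union, Finset.mem_filter, Finset.mem_univ, true_and] at ha ⊢
        by_cases h : (hashSet ι B a).card ≤ c
        · left
          simp only [if_pos h] at ha
          rw [hashEdges, Finset.card_eq_zero, Finset.filter_eq_empty_iff]
          exact fun l _ => ha l
        · right
          omega
      have h1 : ((Finset.univ.filter fun a : Fin 4 → ZMod p => ∀ l,
          ¬(M.left l ∈ (if (hashSet ι B a).card ≤ c then hashSet ι B a else ∅)
            ∧ M.right l ∈ (if (hashSet ι B a).card ≤ c then hashSet ι B a else ∅))).card : ℝ)
          ≤ ((Finset.univ.filter fun a => hashEdges ι B M a = 0).card : ℝ)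
            + ((Finset.univ.filter fun a => c < (hashSet ι B a).card).card : ℝ) := by
        exact_mod_cast (Finset.card_le_card hsub).trans (Finset.card_union_le _ _)
      refine h1.trans ((add_le_add (hmiss M) hlarge).trans (le_of_eq ?_))
      simp
      ring
  refine ⟨_, P, hP, ?_⟩
  have hr1 : (r : ℝ) ≤ X + 1 := by
    have h1 : ((Nat.sqrt n : ℕ) : ℝ) ≤ √(n : ℝ) := Real.nat_sqrt_le_real_sqrt
    rw [hr]
    push_cast
    linarith
  have hb1 : (b : ℝ) ≤ p * A / √m + 1 := by
    have h1 : (b : ℝ) ≤ ⌈(p : ℝ) * A / √m⌉₊ := by exact_mod_cast min_le_right _ _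
    have h2 := Nat.ceil_lt_add_one (show 0 ≤ (p : ℝ) * A / √m by positivity)
    linarith
  have hc1 : (c : ℝ) ≤ 2 / ε * (A + 1) * X + X := by
    have h1 := Nat.ceil_lt_add_one (show 0 ≤ 2 * n * b / (p * ε) by positivity)
    have h2 : 2 * n * b / (p * ε) ≤ 2 / ε * (A + 1) * X := by
      calc 2 * n * b / (p * ε) = 2 / ε * (n * b / p) := by field_simp
        _ ≤ 2 / ε * (n * (p * A / √m + 1) / p) := by gcongr
        _ = 2 / ε * (A * X + n / p) := by
            rw [hX]
            field_simp
        _ ≤ 2 / ε * (A * X + X) := by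
            gcongr
            exact ((div_le_one hpr).mpr hnpr).trans hX1
        _ = _ := by ring
    linarith
  push_cast
  linarith

/-! ### Quantum protocols from real vectors and projections. -/

section Projective

variable {I : Type} [Fintype I]

theorem posSemidef_map_ofReal_of_idempotent {R : Matrix I I ℝ} (hsymm : R.transpose = R)
    (hidem : R * R = R) : (R.map Complex.ofReal).PosSemidef := by
  have h : (R.map Complex.ofReal).conjTranspose * R.map Complex.ofReal = R.map Complex.ofReal := by
    have h1 : (R.map Complex.ofReal).conjTranspose = R.map Complex.ofReal := by
      ext i j
      have := congrFun (congrFun hsymm i) j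
      rw [Matrix.transpose_apply] at this
      simp [this]
    rw [h1]
    have := Matrix.map_mul (L := R) (M := R) (f := Complex.ofRealHom)
    rw [hidem] at this
    exact this.symm
  rw [← h]
  exact Matrix.posSemidef_conjTranspose_mul_self _

/-- The measurement consisting of a real orthogonal projection (outcome `false`) and its
complement (outcome `true`). -/
noncomputable def BinaryMeasurement.ofProjection {k : ℕ}
    (R : Matrix (Fin k → Bool) (Fin k → Bool) ℝ) (hsymm : R.transpose = R) (hidem : R * R = R) :
    BinaryMeasurement k where
  op b := if b then 1 - R.map Complex.ofReal else R.map Complex.ofReal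
  posSemidef b := by
    cases b
    · simpa using posSemidef_map_ofReal_of_idempotent hsymm hidem
    · have h := posSemidef_map_ofReal_of_idempotent (R := 1 - R) (by simp [hsymm])
        (by simp [mul_sub, sub_mul, hidem])
      have e : (1 - R).map Complex.ofReal = 1 - R.map Complex.ofReal := by
        ext i j
        by_cases hij : i = j <;> simp [hij]
      simpa [e] using h
  sum_eq_one := by simp

/-- The pure state given by a real unit vector. -/
noncomputable def QubitState.ofVec {k : ℕ} (φ : (Fin k → Bool) → ℝ) (h : φ ⬝ᵥ φ = 1) :
    QubitState k where
  mat := (Matrix.vecMulVec φ φ).map Complex.ofReal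
  posSemidef := posSemidef_map_ofReal_of_idempotent (Matrix.transpose_vecMulVec _ _) (by
    rw [Matrix.vecMulVec_mul_vecMulVec, h, one_smul])
  trace_eq_one := by
    have h1 : (Matrix.vecMulVec φ φ).trace = 1 := by rw [Matrix.trace_vecMulVec, h]
    have h2 := congrArg Complex.ofReal h1
    simpa [Matrix.trace] using h2

theorem BinaryMeasurement.prob_add_prob {k : ℕ} (E : BinaryMeasurement k) (ρ : QubitState k) :
    E.prob ρ false + E.prob ρ true = 1 := by
  rw [prob, prob, ← Complex.add_re, ← Matrix.trace_add, ← add_mul, E.sum_eq_one, one_mul,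
    ρ.trace_eq_one, Complex.one_re]

theorem BinaryMeasurement.prob_ofProjection_ofVec {k : ℕ}
    (R : Matrix (Fin k → Bool) (Fin k → Bool) ℝ) (hsymm : R.transpose = R) (hidem : R * R = R)
    (φ : (Fin k → Bool) → ℝ) (h : φ ⬝ᵥ φ = 1) :
    (ofProjection R hsymm hidem).prob (.ofVec φ h) false = φ ⬝ᵥ R.mulVec φ := by
  have e : (R * Matrix.vecMulVec φ φ).map Complex.ofReal
      = R.map Complex.ofReal * (Matrix.vecMulVec φ φ).map Complex.ofReal :=
    Matrix.map_mul (f := Complex.ofRealHom)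
  have h1 : (ofProjection R hsymm hidem).prob (.ofVec φ h) false
      = ((R * Matrix.vecMulVec φ φ).map Complex.ofReal).trace.re := by
    rw [e]
    simp [prob, ofProjection, QubitState.ofVec]
  rw [h1, Matrix.mul_vecMulVec, dotProduct_comm, ← Matrix.trace_vecMulVec]
  simp [Matrix.trace]

/-- A one-way protocol from real unit vectors and real orthogonal projections in any finite
dimension. -/
theorem exists_quantumOneWay_of_projections [DecidableEq I] {X Y : Type} {k : ℕ}
    (hI : Fintype.card I ≤ 2 ^ k)
    (ψ : X → I → ℝ) (hψ : ∀ x, ψ x ⬝ᵥ ψ x = 1) (Q : Y → Matrix I I ℝ)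
    (hsymm : ∀ y, (Q y).transpose = Q y) (hidem : ∀ y, Q y * Q y = Q y) {f : PartialBoolFun X Y}
    {ε : ℝ} (h₀ : ∀ x y, f x y = some false → 1 - ε ≤ ψ x ⬝ᵥ (Q y).mulVec (ψ x))
    (h₁ : ∀ x y, f x y = some true → ψ x ⬝ᵥ (Q y).mulVec (ψ x) ≤ ε) :
    ∃ P : QuantumOneWay X Y k, P.Computes f ε := by
  obtain ⟨e⟩ : Nonempty (I ↪ (Fin k → Bool)) :=
    Function.Embedding.nonempty_of_card_le (by simpa using hI)
  -- The isometric embedding into `k` qubits. The unused dimensions fall under outcome `true`, but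
  -- the state has no mass there.
  let V : Matrix (Fin k → Bool) I ℝ := Matrix.of fun s i => if s = e i then 1 else 0
  have hV : V.transpose * V = 1 := by
    ext i j
    simp [Matrix.mul_apply, V, Matrix.one_apply, eq_comm]
  have hVφ : ∀ u v : I → ℝ, V.mulVec u ⬝ᵥ V.mulVec v = u ⬝ᵥ v := by
    intro u v
    rw [Matrix.dotProduct_mulVec, ← Matrix.mulVec_transpose, Matrix.mulVec_mulVec, hV,
      Matrix.one_mulVec]
  have hVidem : ∀ y, V * Q y * V.transpose * (V * Q y * V.transpose) = V * Q y * V.transpose := by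
    intro y
    calc _ = V * (Q y * (V.transpose * V) * Q y) * V.transpose := by simp only [Matrix.mul_assoc]
      _ = _ := by rw [hV, mul_one, hidem]
  have hVsymm : ∀ y, (V * Q y * V.transpose).transpose = V * Q y * V.transpose := by
    intro y
    rw [Matrix.transpose_mul, Matrix.transpose_mul, Matrix.transpose_transpose, hsymm,
      Matrix.mul_assoc]
  refine ⟨⟨fun x => .ofVec (V.mulVec (ψ x)) (by rw [hVφ, hψ]),
    fun y => .ofProjection (V * Q y * V.transpose) (hVsymm y) (hVidem y)⟩, ?_⟩
  intro x y b hb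
  have hprob : (BinaryMeasurement.ofProjection (V * Q y * V.transpose) (hVsymm y)
      (hVidem y)).prob (.ofVec (V.mulVec (ψ x)) (by rw [hVφ, hψ])) false
      = ψ x ⬝ᵥ (Q y).mulVec (ψ x) := by
    rw [BinaryMeasurement.prob_ofProjection_ofVec, Matrix.mulVec_mulVec, Matrix.mul_assoc, hV,
      Matrix.mul_one, ← Matrix.mulVec_mulVec, hVφ]
  cases b
  · rw [hprob]
    exact h₀ x y hb
  · have h1 := h₁ x y hb
    rw [← hprob] at h1
    have h2 := BinaryMeasurement.prob_add_prob (.ofProjection (V * Q y * V.transpose) (hVsymm y)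
      (hVidem y)) (.ofVec (V.mulVec (ψ x)) (by rw [hVφ, hψ]))
    linarith

end Projective

/-! ### Tensor powers, for independent copies of a state. -/

section TensorPower

variable {I : Type}

/-- The `t`-th tensor power of a vector. -/
def tensorPowVec (t : ℕ) (u : I → ℝ) (s : Fin t → I) : ℝ := ∏ i, u (s i)

/-- The `t`-th tensor power of a matrix. -/
def tensorPowMat (t : ℕ) (Q : Matrix I I ℝ) : Matrix (Fin t → I) (Fin t → I) ℝ :=
  fun s s' => ∏ i, Q (s i) (s' i)

theorem tensorPowMat_transpose (t : ℕ) (Q : Matrix I I ℝ) :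
    (tensorPowMat t Q).transpose = tensorPowMat t Q.transpose := rfl

variable [Fintype I]

theorem tensorPowVec_dotProduct (t : ℕ) (u v : I → ℝ) :
    tensorPowVec t u ⬝ᵥ tensorPowVec t v = (u ⬝ᵥ v) ^ t := by
  simp only [dotProduct, tensorPowVec, ← Finset.prod_mul_distrib]
  rw [Fintype.sum_pow]

theorem tensorPowMat_mulVec (t : ℕ) (Q : Matrix I I ℝ) (u : I → ℝ) :
    (tensorPowMat t Q).mulVec (tensorPowVec t u) = tensorPowVec t (Q.mulVec u) := by
  ext s
  simp only [Matrix.mulVec, dotProduct, tensorPowVec, tensorPowMat, ← Finset.prod_mul_distrib]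
  rw [Finset.prod_univ_sum, Fintype.piFinset_univ]

theorem tensorPowMat_mul (t : ℕ) (Q R : Matrix I I ℝ) :
    tensorPowMat t Q * tensorPowMat t R = tensorPowMat t (Q * R) := by
  ext s s'
  simp only [Matrix.mul_apply, tensorPowMat, ← Finset.prod_mul_distrib]
  rw [Finset.prod_univ_sum, Fintype.piFinset_univ]

end TensorPower

/-! ### The fingerprint protocol and its cost. -/

section Fingerprint

variable {n m : ℕ}

/-- The uniform superposition of the vertices with signs given by `x`. -/
noncomputable def fingerprint (x : Fin n → Bool) (i : Fin n) : ℝ := boolSign (x i) / √n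

/-- The matrix whose `l`-th column is the unit vector supported on the `l`-th edge of `M` that is
orthogonal to every fingerprint with parity `w l` on this edge. -/
noncomputable def edgeMatrix (M : PartialMatching n m) (w : Fin m → Bool) :
    Matrix (Fin n) (Fin m) ℝ := fun i l =>
  ((if M.left l = i then 1 else 0) - boolSign (w l) * (if M.right l = i then 1 else 0)) / √2

theorem edgeMatrix_transpose_mulVec (M : PartialMatching n m) (w : Fin m → Bool) (u : Fin n → ℝ)
    (l : Fin m) : (edgeMatrix M w).transpose.mulVec u l
      = (u (M.left l) - boolSign (w l) * u (M.right l)) / √2 := by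
  simp only [Matrix.mulVec, dotProduct, Matrix.transpose_apply, edgeMatrix, div_mul_eq_mul_div,
    sub_mul, mul_assoc, ite_mul, one_mul, zero_mul]
  rw [← Finset.sum_div, Finset.sum_sub_distrib, ← Finset.mul_sum]
  simp

theorem edgeMatrix_transpose_mul_self (M : PartialMatching n m) (w : Fin m → Bool) :
    (edgeMatrix M w).transpose * edgeMatrix M w = 1 := by
  ext l l'
  have h := edgeMatrix_transpose_mulVec M w (fun i => edgeMatrix M w i l') l
  have h' : ((edgeMatrix M w).transpose * edgeMatrix M w) l l'
      = (edgeMatrix M w).transpose.mulVec (fun i => edgeMatrix M w i l') l := rfl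
  rw [h', h]
  have hs := boolSign_mul_self (w l)
  have h2 : √(2 : ℝ) * √2 = 2 := Real.mul_self_sqrt (by norm_num)
  simp only [edgeMatrix, M.left_injective.eq_iff, M.right_injective.eq_iff, M.left_ne_right,
    fun a b => (M.left_ne_right a b).symm, if_false]
  by_cases hl : l' = l
  · subst hl
    simp only [if_true, Matrix.one_apply_eq]
    field_simp
    linear_combination hs - h2
  · simp [hl, Matrix.one_apply_ne' hl]

/-- The projection onto the complement of the columns of `edgeMatrix M w`. -/
noncomputable def edgeProjection (M : PartialMatching n m) (w : Fin m → Bool) :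
    Matrix (Fin n) (Fin n) ℝ := 1 - edgeMatrix M w * (edgeMatrix M w).transpose

theorem edgeProjection_transpose (M : PartialMatching n m) (w : Fin m → Bool) :
    (edgeProjection M w).transpose = edgeProjection M w := by
  simp [edgeProjection]

theorem edgeProjection_mul_self (M : PartialMatching n m) (w : Fin m → Bool) :
    edgeProjection M w * edgeProjection M w = edgeProjection M w := by
  have h : edgeMatrix M w * (edgeMatrix M w).transpose
      * (edgeMatrix M w * (edgeMatrix M w).transpose)
      = edgeMatrix M w * (edgeMatrix M w).transpose := by
    calc _ = edgeMatrix M w * ((edgeMatrix M w).transpose * edgeMatrix M w)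
          * (edgeMatrix M w).transpose := by simp only [Matrix.mul_assoc]
      _ = _ := by rw [edgeMatrix_transpose_mul_self, Matrix.mul_one]
  simp [edgeProjection, mul_sub, sub_mul, h]

theorem fingerprint_dotProduct_self (hn : 0 < n) (x : Fin n → Bool) :
    fingerprint x ⬝ᵥ fingerprint x = 1 := by
  have hnr : (0 : ℝ) < n := by exact_mod_cast hn
  simp only [dotProduct, fingerprint, div_mul_div_comm, boolSign_mul_self,
    Real.mul_self_sqrt hnr.le]
  simp [hnr.ne']

/-- The overlap with each edge vector vanishes when `b` is `false` and has square `2 / n` when `b`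
is `true`; the `m` edge vectors are orthonormal. -/
theorem fingerprint_edgeProjection (hn : 0 < n) {x : Fin n → Bool}
    {y : PartialMatching n m × (Fin m → Bool)} {b : Bool}
    (h : partialMatchingProblem n m x y = some b) :
    fingerprint x ⬝ᵥ (edgeProjection y.1 y.2).mulVec (fingerprint x)
      = if b then 1 - 2 * m / (n : ℝ) else 1 := by
  have hnr : (0 : ℝ) < n := by exact_mod_cast hn
  have hl : ∀ l, (edgeMatrix y.1 y.2).transpose.mulVec (fingerprint x) l
      = boolSign (x (y.1.left l)) * (1 - boolSign b) / (√n * √2) := by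
    intro l
    rw [edgeMatrix_transpose_mulVec, eq_parities_of_partialMatchingProblem_eq_some h,
      PartialMatching.parities, boolSign_xor, boolSign_xor, fingerprint, fingerprint]
    have := boolSign_mul_self (x (y.1.right l))
    field_simp
    linear_combination (-boolSign b * boolSign (x (y.1.left l))) * this
  rw [edgeProjection, Matrix.sub_mulVec, Matrix.one_mulVec, dotProduct_sub,
    fingerprint_dotProduct_self hn, ← Matrix.mulVec_mulVec, Matrix.dotProduct_mulVec,
    ← Matrix.mulVec_transpose, dotProduct]
  simp only [hl, div_mul_div_comm]
  have e : ∀ l, boolSign (x (y.1.left l)) * (1 - boolSign b)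
      * (boolSign (x (y.1.left l)) * (1 - boolSign b)) / (√n * √2 * (√n * √2))
      = (1 - boolSign b) ^ 2 / (2 * n) := by
    intro l
    rw [show √(n : ℝ) * √2 * (√n * √2) = (√n * √n) * (√2 * √2) by ring,
      Real.mul_self_sqrt hnr.le, Real.mul_self_sqrt zero_le_two, mul_mul_mul_comm,
      boolSign_mul_self]
    ring
  simp only [e]
  cases b
  · simp [boolSign]
  · simp [boolSign]
    field_simp
    ring

theorem clog_two_le {n : ℕ} (hn : 2 ≤ n) :
    (Nat.clog 2 n : ℝ) ≤ 2 / Real.log 2 * Real.log n := by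
  have hlog2 : 0 < Real.log 2 := Real.log_pos one_lt_two
  have hq : 1 ≤ Nat.clog 2 n := Nat.clog_pos one_lt_two hn
  have h1 : 2 ^ (Nat.clog 2 n - 1) ≤ n := (Nat.pow_pred_clog_lt_self one_lt_two hn).le
  have h2 : ((Nat.clog 2 n - 1 : ℕ) : ℝ) * Real.log 2 ≤ Real.log n := by
    rw [← Real.log_pow]
    exact Real.log_le_log (by positivity) (by exact_mod_cast h1)
  have h3 : Real.log 2 ≤ Real.log n := Real.log_le_log two_pos (by exact_mod_cast hn)
  rw [Nat.cast_sub hq, Nat.cast_one] at h2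
  rw [div_mul_eq_mul_div, le_div_iff₀ hlog2]
  linarith

/-- A quantum one-way protocol for Partial Matching in which Alice sends copies of the
fingerprint of her input. -/
theorem exists_quantum_upper_bound {ε : ℝ} (hε : 0 < ε) (hε1 : ε < 1) :
    ∃ K : ℝ, 0 < K ∧ ∀ {n m : ℕ}, 0 < m → 4 * m ≤ n →
      ∃ (k : ℕ) (P : QuantumOneWay (Fin n → Bool) (PartialMatching n m × (Fin m → Bool)) k),
        P.Computes (partialMatchingProblem n m) ε ∧ (k : ℝ) ≤ K * (n / m * Real.log n) := by
  have hlog2 : 0 < Real.log 2 := Real.log_pos one_lt_two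
  have hL : 0 < -Real.log ε := neg_pos.mpr (Real.log_neg hε hε1)
  refine ⟨(-Real.log ε / 2 + 1) * (2 / Real.log 2), by positivity, ?_⟩
  intro n m hm hmn
  have hmr : (0 : ℝ) < m := by exact_mod_cast hm
  have hmn' : 4 * (m : ℝ) ≤ n := by exact_mod_cast hmn
  have hnr : (0 : ℝ) < n := by linarith
  -- The number of copies for which `(1 - 2 * m / n) ^ t ≤ exp (-2 * m * t / n) ≤ ε`. Outcome
  -- `false` of the tensor power means that every copy passed the test.
  set t : ℕ := ⌈(n / m : ℝ) * (-Real.log ε / 2)⌉₊ with ht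
  have hcard : Fintype.card (Fin t → Fin n) ≤ 2 ^ (t * Nat.clog 2 n) := by
    rw [Fintype.card_pi]
    simp only [Fintype.card_fin, Finset.prod_const, Finset.card_univ]
    rw [mul_comm, pow_mul]
    exact Nat.pow_le_pow_left (Nat.le_pow_clog one_lt_two n) t
  have hval : ∀ (x : Fin n → Bool) (y : PartialMatching n m × (Fin m → Bool)),
      tensorPowVec t (fingerprint x) ⬝ᵥ
        (tensorPowMat t (edgeProjection y.1 y.2)).mulVec (tensorPowVec t (fingerprint x))
      = (fingerprint x ⬝ᵥ (edgeProjection y.1 y.2).mulVec (fingerprint x)) ^ t := fun x y => by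
    rw [tensorPowMat_mulVec, tensorPowVec_dotProduct]
  obtain ⟨P, hP⟩ := exists_quantumOneWay_of_projections (f := partialMatchingProblem n m)
    (ε := ε) hcard (fun x => tensorPowVec t (fingerprint x))
    (fun x => by rw [tensorPowVec_dotProduct, fingerprint_dotProduct_self (by omega), one_pow])
    (fun y => tensorPowMat t (edgeProjection y.1 y.2))
    (fun y => by rw [tensorPowMat_transpose, edgeProjection_transpose])
    (fun y => by rw [tensorPowMat_mul, edgeProjection_mul_self])
    (fun x y h => by
      rw [hval, fingerprint_edgeProjection (by omega) h]
      simp [hε.le])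
    (fun x y h => by
      rw [hval, fingerprint_edgeProjection (by omega) h, if_pos rfl]
      have h0 : 0 ≤ 1 - 2 * m / (n : ℝ) := by
        rw [sub_nonneg, div_le_one hnr]
        linarith
      calc (1 - 2 * m / (n : ℝ)) ^ t ≤ Real.exp (-(2 * m / (n : ℝ))) ^ t := by
            gcongr
            exact Real.one_sub_le_exp_neg _
        _ = Real.exp (-(2 * m / n * t)) := by
            rw [← Real.exp_nat_mul]
            ring_nf
        _ ≤ Real.exp (Real.log ε) := by
            rw [Real.exp_le_exp, neg_le]
            calc -Real.log ε = 2 * m / n * ((n / m : ℝ) * (-Real.log ε / 2)) := by field_simp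
              _ ≤ _ := by
                gcongr
                exact Nat.le_ceil _
        _ = ε := Real.exp_log hε)
  refine ⟨_, P, hP, ?_⟩
  have ht1 : (t : ℝ) ≤ n / m * (-Real.log ε / 2 + 1) := by
    have h1 := Nat.ceil_lt_add_one (show 0 ≤ (n / m : ℝ) * (-Real.log ε / 2) by positivity)
    have h2 : (1 : ℝ) ≤ n / m := by
      rw [one_le_div hmr]
      linarith
    rw [mul_add, mul_one]
    linarith
  have hq := clog_two_le (n := n) (by omega)
  push_cast
  calc (t : ℝ) * Nat.clog 2 n
      ≤ (n / m * (-Real.log ε / 2 + 1)) * (2 / Real.log 2 * Real.log n) := by gcongr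
    _ = _ := by ring

end Fingerprint

/-! ### Attained minima and the final assembly. -/

theorem exists_least_of_iInf {p : ℕ → Prop} {k₀ : ℕ} (h₀ : p k₀) :
    ∃ r : ℕ, (⨅ (k : ℕ) (_ : p k), (k : ℕ∞)) = (r : ℕ∞) ∧ p r ∧ ∀ k, p k → r ≤ k := by
  classical
  have hex : ∃ k, p k := ⟨k₀, h₀⟩
  refine ⟨Nat.find hex, le_antisymm (iInf₂_le _ (Nat.find_spec hex)) ?_, Nat.find_spec hex,
    fun k hk => Nat.find_min' hex hk⟩
  exact le_iInf₂ fun k hk => by exact_mod_cast Nat.find_min' hex hk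

theorem exists_complexity_bounds {ε : ℝ} (hε₀ : 0 < ε) (hε : ε < 1 / 2) :
    ∃ c C K : ℝ, 0 < c ∧ 0 < C ∧ 0 < K ∧ ∀ {n m : ℕ}, 0 < m → 4 * m ≤ n →
      ∃ r q : ℕ,
        classicalOneWayComplexity (partialMatchingProblem n m) ε = (r : ℕ∞) ∧
        quantumOneWayComplexity (partialMatchingProblem n m) ε = (q : ℕ∞) ∧
        c * (n / √m) ≤ (r : ℝ) ∧ (r : ℝ) ≤ C * (n / √m) ∧
        (q : ℝ) ≤ K * (n / m * Real.log n) := by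
  obtain ⟨c, hc, hlow⟩ := exists_classical_lower_bound hε
  obtain ⟨C, hC, hup⟩ := exists_classical_upper_bound hε₀
  obtain ⟨K, hK, hq⟩ := exists_quantum_upper_bound hε₀ (by linarith)
  refine ⟨c, C, K, hc, hC, hK, ?_⟩
  intro n m hm hmn
  obtain ⟨k, P, hP, hk⟩ := hup hm hmn
  obtain ⟨k', P', hP', hk'⟩ := hq hm hmn
  obtain ⟨r, hr, ⟨R, hR⟩, hrmin⟩ := exists_least_of_iInf
    (p := fun k => ∃ P : ClassicalOneWay _ _ k, P.Computes (partialMatchingProblem n m) ε) ⟨P, hP⟩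
  obtain ⟨q, hq, -, hqmin⟩ := exists_least_of_iInf
    (p := fun k => ∃ P : QuantumOneWay _ _ k, P.Computes (partialMatchingProblem n m) ε) ⟨P', hP'⟩
  exact ⟨r, q, hr, hq, hlow hm hmn hR,
    le_trans (by exact_mod_cast hrmin k ⟨P, hP⟩) hk,
    le_trans (by exact_mod_cast hqmin k' ⟨P', hP'⟩) hk'⟩

theorem theorem2 (ε : ℝ) (hε₀ : 0 < ε) (hε : ε < 1 / 2) :
    (∃ c C K : ℝ, 0 < c ∧ 0 < C ∧ 0 < K ∧
      ∀ (α : ℝ) (n m : ℕ), 0 < α → α ≤ 1 / 4 → 0 < n → α * (n : ℝ) = (m : ℝ) →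
        ∃ r q : ℕ,
          classicalOneWayComplexity (partialMatchingProblem n m) ε = (r : ℕ∞) ∧
          quantumOneWayComplexity (partialMatchingProblem n m) ε = (q : ℕ∞) ∧
          c * Real.sqrt ((n : ℝ) / α) ≤ (r : ℝ) ∧
          (r : ℝ) ≤ C * Real.sqrt ((n : ℝ) / α) ∧
          (q : ℝ) ≤ K * (Real.log (n : ℝ) / α)) ∧
    (∃ c K : ℝ, 0 < c ∧ 0 < K ∧
      ∀ n m : ℕ, 0 < n → n = 4 * m →
        ∃ r q : ℕ,
          classicalOneWayComplexity (partialMatchingProblem n m) ε = (r : ℕ∞) ∧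
          quantumOneWayComplexity (partialMatchingProblem n m) ε = (q : ℕ∞) ∧
          c * Real.sqrt (n : ℝ) ≤ (r : ℝ) ∧
          (q : ℝ) ≤ K * Real.log (n : ℝ)) := by
  obtain ⟨c, C, K, hc, hC, hK, h⟩ := exists_complexity_bounds hε₀ hε
  refine ⟨⟨c, C, K, hc, hC, hK, ?_⟩, ⟨c, 4 * K, hc, by positivity, ?_⟩⟩
  · intro α n m hα hα4 hn hαn
    have hnr : (0 : ℝ) < n := by exact_mod_cast hn
    have hmr : (0 : ℝ) < m := by
      rw [← hαn]
      positivity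
    have hmn : 4 * m ≤ n := by
      have : 4 * (m : ℝ) ≤ n := by
        rw [← hαn]
        nlinarith
      exact_mod_cast this
    have hα' : α = m / n := by
      rw [eq_div_iff hnr.ne']
      exact hαn
    obtain ⟨r, q, hr, hq, h1, h2, h3⟩ := h (by exact_mod_cast hmr) hmn
    -- Since `α = m / n`, the quotient `n / α` equals `n ^ 2 / m`.
    have e1 : √((n : ℝ) / α) = n / √m := by
      rw [hα', div_div_eq_mul_div, Real.sqrt_div (by positivity), Real.sqrt_mul_self hnr.le]
    have e2 : Real.log n / α = n / m * Real.log n := by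
      rw [hα', div_div_eq_mul_div]
      ring
    rw [e1, e2]
    exact ⟨r, q, hr, hq, h1, h2, h3⟩
  · rintro n m hn rfl
    have hm : 0 < m := by omega
    have hmr : (0 : ℝ) < m := by exact_mod_cast hm
    obtain ⟨r, q, hr, hq, h1, -, h3⟩ := h hm le_rfl
    refine ⟨r, q, hr, hq, le_trans ?_ h1, h3.trans (le_of_eq ?_)⟩
    · gcongr
      exact sqrt_le_div_sqrt hm le_rfl
    · push_cast
      field_simp
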